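/- Let $\mathbb E^5_2$ be $\mathbb R^5$ with the inner product $\langle v,w\rangle=-v_1w_1-v_2w_2+v_3w_3+v_4w_4+v_5w_5$, and let $\mathbb S^4_2(1)=\{v\in\mathbb E^5_2:\langle v,v\rangle=1\}$. Let $M$ be a smooth Lorentzian surface immersed in $\mathbb S^4_2(1)$ that is minimal in $\mathbb S^4_2(1)$ (its mean curvature vector in $\mathbb S^4_2(1)$ vanishes identically). Let $K$ be its Gaussian curvature, and let $K^D=-\langle R^D(f_1,f_2)f_3,f_4\rangle$ be its normal curvature in $\mathbb S^4_2(1)$, where $R^D$ is the curvature tensor of the normal connection of $M$ in $\mathbb S^4_2(1)$ and $f_1,f_2$ (tangent), $f_3,f_4$ (normal) is a local frame field with $\langle f_1,f_2\rangle=\langle f_3,f_4\rangle=-1$ and all other products $\langle f_A,f_B\rangle$ equal to zero. (Exchanging $f_1,f_2$ or $f_3,f_4$ changes the sign of $K^D$; that $K^D$ equals a constant $\kappa$ means that it equals $\kappa$ at every point for a suitable such frame near that point.) If $K$ is constant and $K^D$ is a non-zero constant, then $M$ is locally congruent to a surface $$x(s,t)=\frac{s^2}{2}\,\alpha(t)+s\,\beta(t)+\gamma(t)$$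 whose induced metric is $$g=-(ds\otimes dt+dt\otimes ds)+2\widetilde m\,dt\otimes dt,$$ where $\alpha,\beta,\gamma$ are smooth $\mathbb E^5_2$-valued maps and $\widetilde m$ is a smooth function. That is, every point of $M$ has an open neighbourhood with smooth coordinates $(s,t)$ in which, up to a linear isometry of $\mathbb E^5_2$, the position vector of $M$ is $x(s,t)$ as above, with $\alpha,\beta,\gamma$ smooth on an open interval containing all the values of $t$ and $\widetilde m$ smooth on the coordinate domain, and in which the induced metric is $g$. -/

import Mathlib

open scoped Manifold ContDiff

noncomputable section

namespace MinLor

/-- The coordinate plane `ℝ²`, on which surfaces are modelled. -/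
abbrev Plane : Type := EuclideanSpace ℝ (Fin 2)

/-- The underlying vector space of the pseudo-Euclidean space `𝔼⁵₂`. -/
abbrev E52 : Type := Fin 5 → ℝ

/-- The canonical indefinite inner product of index 2 of `𝔼⁵₂`. -/
def ip (v w : E52) : ℝ :=
  -(v 0 * w 0) - v 1 * w 1 + v 2 * w 2 + v 3 * w 3 + v 4 * w 4

/-- The pseudo-sphere `𝕊⁴₂(1) = {v ∈ 𝔼⁵₂ : ⟨v, v⟩ = 1}`. -/
def pseudoSphere : Set E52 := {v | ip v v = 1}

/-! ### Geometry of a local parametrization `F : ℝ² → 𝔼⁵₂` (only its germs matter) -/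

/-- The `i`-th coordinate vector of the plane. -/
def basisVec (i : Fin 2) : Plane := EuclideanSpace.single i 1

/-- The `i`-th partial derivative of a map on the plane. -/
def pd {W : Type*} [NormedAddCommGroup W] [NormedSpace ℝ W]
    (i : Fin 2) (f : Plane → W) (q : Plane) : W :=
  fderiv ℝ f q (basisVec i)

/-- The metric `g` induced by `F`, as a bilinear form at `q` on coordinate vectors. -/
def inducedMetric (F : Plane → E52) (q a b : Plane) : ℝ :=
  ip (fderiv ℝ F q a) (fderiv ℝ F q b)

/-- The matrix `(g_ij)` of the induced metric. -/
def gram (F : Plane → E52) (q : Plane) : Matrix (Fin 2) (Fin 2) ℝ :=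
  Matrix.of fun i j => inducedMetric F q (basisVec i) (basisVec j)

/-- The Christoffel symbols
`Γ^k_ij = 1/2 ∑_l g^kl (∂_i g_jl + ∂_j g_il - ∂_l g_ij)` of the induced metric. -/
def christoffel (F : Plane → E52) (k i j : Fin 2) (q : Plane) : ℝ :=
  (1 / 2 : ℝ) * ∑ l, (gram F q)⁻¹ k l *
    (pd i (fun r => gram F r j l) q + pd j (fun r => gram F r i l) q
      - pd l (fun r => gram F r i j) q)

/-- The Levi-Civita connection `∇_X Y` of the induced metric, for vector fields in coordinates. -/
def leviCivita (F : Plane → E52) (X Y : Plane → Plane) (q : Plane) : Plane :=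
  WithLp.toLp 2 fun k =>
    fderiv ℝ (fun r => Y r k) q (X q) + ∑ i, ∑ j, christoffel F k i j q * X q i * Y q j

/-- The curvature tensor `R(X, Y) Z = ∇_X ∇_Y Z - ∇_Y ∇_X Z - ∇_[X, Y] Z`. -/
def curvature (F : Plane → E52) (X Y Z : Plane → Plane) (q : Plane) : Plane :=
  leviCivita F X (leviCivita F Y Z) q - leviCivita F Y (leviCivita F X Z) q
    - leviCivita F (VectorField.lieBracket ℝ X Y) Z q

/-- The Gaussian curvature `K = ⟨R(X, Y) Y, X⟩ / (⟨X, X⟩⟨Y, Y⟩ - ⟨X, Y⟩²)`,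
evaluated on the coordinate fields. -/
def gaussK (F : Plane → E52) (q : Plane) : ℝ :=
  inducedMetric F q
      (curvature F (fun _ => basisVec 0) (fun _ => basisVec 1) (fun _ => basisVec 1) q)
      (basisVec 0) /
    (inducedMetric F q (basisVec 0) (basisVec 0) * inducedMetric F q (basisVec 1) (basisVec 1)
      - inducedMetric F q (basisVec 0) (basisVec 1) ^ 2)

/-- The second fundamental form `h(∂_i, ∂_j) = ∂_i ∂_j F - dF(∇_{∂_i} ∂_j)` in `𝔼⁵₂`
(Gauss formula). -/
def secondFF (F : Plane → E52) (i j : Fin 2) (q : Plane) : E52 :=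
  pd i (pd j F) q - fderiv ℝ F q (leviCivita F (fun _ => basisVec i) (fun _ => basisVec j) q)

/-- The second fundamental form in the pseudo-sphere: the part of `h` orthogonal to the position
vector, which is the unit normal of the pseudo-sphere in `𝔼⁵₂`. -/
def secondFFSphere (F : Plane → E52) (i j : Fin 2) (q : Plane) : E52 :=
  secondFF F i j q - ip (secondFF F i j q) (F q) • F q

/-- The mean curvature vector `1/2 ∑ g^ij h_ij` in the pseudo-sphere. -/
def meanCurvature (F : Plane → E52) (q : Plane) : E52 :=
  (1 / 2 : ℝ) • ∑ i, ∑ j, (gram F q)⁻¹ i j • secondFFSphere F i j q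

/-- Orthogonal projection of `𝔼⁵₂` onto the normal space, in the pseudo-sphere, of the surface
at `F q`: the tangential part and the part along the position vector are removed. -/
def normalProj (F : Plane → E52) (q : Plane) (v : E52) : E52 :=
  v - ip v (F q) • F q - ∑ i, ∑ j, ((gram F q)⁻¹ i j * ip v (pd i F q)) • pd j F q

/-- The normal connection `D_X ξ` of the surface in the pseudo-sphere. -/
def normalConn (F : Plane → E52) (X : Plane → Plane) (ξ : Plane → E52) (q : Plane) : E52 :=
  normalProj F q (fderiv ℝ ξ q (X q))

/-- The normal curvature tensor `R^D(X, Y) ξ = D_X D_Y ξ - D_Y D_X ξ - D_[X, Y] ξ`. -/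
def normalCurvTensor (F : Plane → E52) (X Y : Plane → Plane) (ξ : Plane → E52)
    (q : Plane) : E52 :=
  normalConn F X (normalConn F Y ξ) q - normalConn F Y (normalConn F X ξ) q
    - normalConn F (VectorField.lieBracket ℝ X Y) ξ q

/-- `{dF(X₁), dF(X₂); ξ₃, ξ₄}` is a smooth pseudo-orthonormal frame field on `U`, tangent
respectively normal (in the pseudo-sphere) to the surface, with
`⟨f₁, f₂⟩ = ⟨f₃, f₄⟩ = -1` and all other products zero. -/
structure IsPseudoOrthonormalFrame (F : Plane → E52) (U : Set Plane)
    (X₁ X₂ : Plane → Plane) (ξ₃ ξ₄ : Plane → E52) : Prop where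
  smooth₁ : ContDiffOn ℝ ∞ X₁ U
  smooth₂ : ContDiffOn ℝ ∞ X₂ U
  smooth₃ : ContDiffOn ℝ ∞ ξ₃ U
  smooth₄ : ContDiffOn ℝ ∞ ξ₄ U
  tangent₁₁ : ∀ q ∈ U, inducedMetric F q (X₁ q) (X₁ q) = 0
  tangent₁₂ : ∀ q ∈ U, inducedMetric F q (X₁ q) (X₂ q) = -1
  tangent₂₂ : ∀ q ∈ U, inducedMetric F q (X₂ q) (X₂ q) = 0
  normal₃ : ∀ q ∈ U, ip (ξ₃ q) (F q) = 0 ∧ ∀ a, ip (ξ₃ q) (fderiv ℝ F q a) = 0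
  normal₄ : ∀ q ∈ U, ip (ξ₄ q) (F q) = 0 ∧ ∀ a, ip (ξ₄ q) (fderiv ℝ F q a) = 0
  normal₃₃ : ∀ q ∈ U, ip (ξ₃ q) (ξ₃ q) = 0
  normal₃₄ : ∀ q ∈ U, ip (ξ₃ q) (ξ₄ q) = -1
  normal₄₄ : ∀ q ∈ U, ip (ξ₄ q) (ξ₄ q) = 0

/-- `κ` is the normal curvature `K^D = -⟨R^D(f₁, f₂) f₃, f₄⟩` at `q`, with respect to some
pseudo-orthonormal frame field near `q`. Exchanging `f₁, f₂` or `f₃, f₄` reverses the sign of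
`K^D`, so that `κ` is determined up to sign; a choice of orientations of the tangent and the
normal bundle is a choice of this sign. -/
def IsNormalCurvatureAt (F : Plane → E52) (q : Plane) (κ : ℝ) : Prop :=
  ∃ (U : Set Plane) (X₁ X₂ : Plane → Plane) (ξ₃ ξ₄ : Plane → E52),
    IsOpen U ∧ q ∈ U ∧ IsPseudoOrthonormalFrame F U X₁ X₂ ξ₃ ξ₄ ∧
      κ = -ip (normalCurvTensor F X₁ X₂ ξ₃ q) (ξ₄ q)

/-! ### Surfaces in the pseudo-sphere -/

section Surface

variable {M : Type*} [TopologicalSpace M] [ChartedSpace Plane M]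

/-- `x : M → 𝔼⁵₂` makes `M` a smooth (immersed) Lorentzian surface in `𝕊⁴₂(1)`: `x` is smooth with
values in `𝕊⁴₂(1)`, and every tangent plane of `M` has an orthonormal basis `X, Y` for the induced
metric with `⟨X, X⟩ = -1` and `⟨Y, Y⟩ = 1`. In particular `x` is an immersion. -/
structure IsLorentzianSurface (x : M → E52) : Prop where
  smooth : ContMDiff (𝓡 2) 𝓘(ℝ, E52) ∞ x
  mem_sphere : ∀ p, x p ∈ pseudoSphere
  lorentzian : ∀ p, ∃ X Y : TangentSpace (𝓡 2) p,
    ip (mfderiv (𝓡 2) 𝓘(ℝ, E52) x p X) (mfderiv (𝓡 2) 𝓘(ℝ, E52) x p X) = -1 ∧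
    ip (mfderiv (𝓡 2) 𝓘(ℝ, E52) x p X) (mfderiv (𝓡 2) 𝓘(ℝ, E52) x p Y) = 0 ∧
    ip (mfderiv (𝓡 2) 𝓘(ℝ, E52) x p Y) (mfderiv (𝓡 2) 𝓘(ℝ, E52) x p Y) = 1

/-- The surface is minimal in `𝕊⁴₂(1)`: its mean curvature vector vanishes, in every chart. -/
def IsMinimal (x : M → E52) : Prop :=
  ∀ e ∈ IsManifold.maximalAtlas (𝓡 2) ∞ M, ∀ q ∈ e.target,
    meanCurvature (x ∘ e.symm) q = 0

/-- The Gaussian curvature of the surface is everywhere equal to `K`, in every chart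
(the Gaussian curvature does not depend on the chart). -/
def HasGaussianCurvature (x : M → E52) (K : ℝ) : Prop :=
  ∀ e ∈ IsManifold.maximalAtlas (𝓡 2) ∞ M, ∀ q ∈ e.target,
    gaussK (x ∘ e.symm) q = K

/-- The normal curvature of the surface in `𝕊⁴₂(1)` is everywhere equal to `κ`, with respect to
suitable pseudo-orthonormal frames near each point (no orientability is required). -/
def HasNormalCurvature (x : M → E52) (κ : ℝ) : Prop :=
  ∀ e ∈ IsManifold.maximalAtlas (𝓡 2) ∞ M, ∀ q ∈ e.target,
    IsNormalCurvatureAt (x ∘ e.symm) q κ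

end Surface

end MinLor

end

open MinLor

noncomputable section

open Set Filter Topology

/-! ### The inner product -/

/-! Take null tangent fields `X, Y` and null normal fields `ξ, η`. Minimality kills the mixed term
of the second fundamental form, leaving `h(X, X) = a ξ + b η` and `h(Y, Y) = c ξ + d η`. The Gauss
and Ricci equations give `K = 1 + a d + b c` and `K^D = a d - b c` (`gaussK_eq`, `normalCurv_eq`),
so constant curvatures make `a d` and `b c` constant. The sign of `K^D` may depend on the frame, but
its square does not (`normalCurv_sq_eq`), and continuity fixes the sign on a ball.

If `a d` is a non-zero constant, the Codazzi equations determine both derivatives of `a`, and their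
integrability condition reads `2 K = -K^D` (`curvature_relation`). If `b c` is a non-zero constant,
exchanging `ξ, η` gives `2 K = K^D`. Both cannot hold when `K^D ≠ 0`, so exactly one product is
non-zero; say `b c = 0`. By Codazzi, `b` solves a linear equation along `Y` and `c` one along `X`.
The integral curves of the two fields meet, so `b` or `c` vanishes near each point
(`eventually_eq_zero_or_of_mul_eq_zero`); after an exchange, `b = 0`.

Now the direction of `ξ` is constant along `X`, and the `X`-derivative of `dF(X)` lies in the span
of `dF(X)` and `ξ`. A ratio `t` of components of `ξ` is constant along `X`, and `l = Y t` is
non-zero because `d` is. Along the rescaled null field `l X` the second derivative of `F` is `A = l²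
a ξ`, and `X A = 0`. Hence `F` is a quadratic polynomial in a parameter `s` of `l X`, and `(s, t)`
are the required coordinates (`exists_quadratic_coordinates`). -/

lemma ip_comm (v w : E52) : ip v w = ip w v := by unfold ip; ring

lemma ip_add_left (u v w : E52) : ip (u + v) w = ip u w + ip v w := by
  simp only [ip, Pi.add_apply]; ring

lemma ip_add_right (u v w : E52) : ip u (v + w) = ip u v + ip u w := by
  simp only [ip, Pi.add_apply]; ring

lemma ip_smul_left (c : ℝ) (v w : E52) : ip (c • v) w = c * ip v w := by
  simp only [ip, Pi.smul_apply, smul_eq_mul]; ring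

lemma ip_smul_right (c : ℝ) (v w : E52) : ip v (c • w) = c * ip v w := by
  simp only [ip, Pi.smul_apply, smul_eq_mul]; ring

lemma ip_neg_left (v w : E52) : ip (-v) w = -ip v w := by
  simp only [ip, Pi.neg_apply]; ring

lemma ip_sub_left (u v w : E52) : ip (u - v) w = ip u w - ip v w := by
  simp only [ip, Pi.sub_apply]; ring

lemma ip_zero_left (w : E52) : ip 0 w = 0 := by simp [ip]

/-- A null basis of `𝔼⁵₂`: two hyperbolic pairs and an orthogonal unit vector. -/
structure IsNullBasis (e₁ e₂ n₁ n₂ p : E52) : Prop where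
  e₁₁ : ip e₁ e₁ = 0
  e₁₂ : ip e₁ e₂ = -1
  e₂₂ : ip e₂ e₂ = 0
  n₁₁ : ip n₁ n₁ = 0
  n₁₂ : ip n₁ n₂ = -1
  n₂₂ : ip n₂ n₂ = 0
  pp : ip p p = 1
  ne₁₁ : ip n₁ e₁ = 0
  ne₁₂ : ip n₁ e₂ = 0
  ne₂₁ : ip n₂ e₁ = 0
  ne₂₂ : ip n₂ e₂ = 0
  pe₁ : ip p e₁ = 0
  pe₂ : ip p e₂ = 0
  pn₁ : ip p n₁ = 0
  pn₂ : ip p n₂ = 0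

namespace IsNullBasis

variable {e₁ e₂ n₁ n₂ p : E52}

lemma e₂₁ (h : IsNullBasis e₁ e₂ n₁ n₂ p) : ip e₂ e₁ = -1 := by rw [ip_comm, h.e₁₂]
lemma n₂₁ (h : IsNullBasis e₁ e₂ n₁ n₂ p) : ip n₂ n₁ = -1 := by rw [ip_comm, h.n₁₂]
lemma en₁₁ (h : IsNullBasis e₁ e₂ n₁ n₂ p) : ip e₁ n₁ = 0 := by rw [ip_comm, h.ne₁₁]
lemma en₁₂ (h : IsNullBasis e₁ e₂ n₁ n₂ p) : ip e₁ n₂ = 0 := by rw [ip_comm, h.ne₂₁]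
lemma en₂₁ (h : IsNullBasis e₁ e₂ n₁ n₂ p) : ip e₂ n₁ = 0 := by rw [ip_comm, h.ne₁₂]
lemma en₂₂ (h : IsNullBasis e₁ e₂ n₁ n₂ p) : ip e₂ n₂ = 0 := by rw [ip_comm, h.ne₂₂]
lemma ep₁ (h : IsNullBasis e₁ e₂ n₁ n₂ p) : ip e₁ p = 0 := by rw [ip_comm, h.pe₁]
lemma ep₂ (h : IsNullBasis e₁ e₂ n₁ n₂ p) : ip e₂ p = 0 := by rw [ip_comm, h.pe₂]
lemma np₁ (h : IsNullBasis e₁ e₂ n₁ n₂ p) : ip n₁ p = 0 := by rw [ip_comm, h.pn₁]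
lemma np₂ (h : IsNullBasis e₁ e₂ n₁ n₂ p) : ip n₂ p = 0 := by rw [ip_comm, h.pn₂]

lemma swap_tangent (h : IsNullBasis e₁ e₂ n₁ n₂ p) : IsNullBasis e₂ e₁ n₁ n₂ p :=
  ⟨h.e₂₂, h.e₂₁, h.e₁₁, h.n₁₁, h.n₁₂, h.n₂₂, h.pp, h.ne₁₂, h.ne₁₁, h.ne₂₂, h.ne₂₁, h.pe₂, h.pe₁,
    h.pn₁, h.pn₂⟩

lemma swap_normal (h : IsNullBasis e₁ e₂ n₁ n₂ p) : IsNullBasis e₁ e₂ n₂ n₁ p :=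
  ⟨h.e₁₁, h.e₁₂, h.e₂₂, h.n₂₂, h.n₂₁, h.n₁₁, h.pp, h.ne₂₁, h.ne₂₂, h.ne₁₁, h.ne₁₂, h.pe₁, h.pe₂,
    h.pn₂, h.pn₁⟩

/-- The products of a linear combination with the vectors of the basis. -/
lemma ip_comb (h : IsNullBasis e₁ e₂ n₁ n₂ p) (x y z w u : ℝ) :
    ip (x • e₁ + y • e₂ + z • n₁ + w • n₂ + u • p) e₁ = -y ∧
    ip (x • e₁ + y • e₂ + z • n₁ + w • n₂ + u • p) e₂ = -x ∧
    ip (x • e₁ + y • e₂ + z • n₁ + w • n₂ + u • p) n₁ = -w ∧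
    ip (x • e₁ + y • e₂ + z • n₁ + w • n₂ + u • p) n₂ = -z ∧
    ip (x • e₁ + y • e₂ + z • n₁ + w • n₂ + u • p) p = u := by
  refine ⟨?_, ?_, ?_, ?_, ?_⟩ <;>
  simp only [ip_add_left, ip_smul_left, h.e₁₁, h.e₁₂, h.e₂₁, h.e₂₂, h.n₁₁, h.n₁₂, h.n₂₁, h.n₂₂,
    h.en₁₁, h.en₁₂, h.en₂₁, h.en₂₂, h.ne₁₁, h.ne₁₂, h.ne₂₁, h.ne₂₂, h.pp, h.pe₁, h.pe₂, h.pn₁,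
    h.pn₂, h.np₁, h.np₂, h.ep₁, h.ep₂] <;> ring

lemma coeff_eq_zero (h : IsNullBasis e₁ e₂ n₁ n₂ p) {x y z w u : ℝ}
    (h0 : x • e₁ + y • e₂ + z • n₁ + w • n₂ + u • p = 0) :
    x = 0 ∧ y = 0 ∧ z = 0 ∧ w = 0 ∧ u = 0 := by
  obtain ⟨h1, h2, h3, h4, h5⟩ := h.ip_comb x y z w u
  rw [h0, ip_zero_left] at h1 h2 h3 h4 h5
  exact ⟨by linarith, by linarith, by linarith, by linarith, by linarith⟩

/-- Pairing a linear relation with the five vectors returns its coefficients up to sign, so the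
vectors are independent, and five independent vectors span. -/
lemma exists_comb (h : IsNullBasis e₁ e₂ n₁ n₂ p) (v : E52) :
    ∃ x y z w u : ℝ, v = x • e₁ + y • e₂ + z • n₁ + w • n₂ + u • p := by
  have hli : LinearIndependent ℝ ![e₁, e₂, n₁, n₂, p] := by
    rw [Fintype.linearIndependent_iff]
    intro g hg
    rw [Fin.sum_univ_five] at hg
    obtain ⟨h0, h1, h2, h3, h4⟩ := h.coeff_eq_zero hg
    intro i
    fin_cases i <;> assumption
  have hspan := hli.span_eq_top_of_card_eq_finrank (by simp)
  have hv : v ∈ Submodule.span ℝ (range ![e₁, e₂, n₁, n₂, p]) := by rw [hspan]; trivial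
  obtain ⟨g, rfl⟩ := (Submodule.mem_span_range_iff_exists_fun ℝ).1 hv
  exact ⟨g 0, g 1, g 2, g 3, g 4, by rw [Fin.sum_univ_five]; rfl⟩

/-- The expansion of a vector in a null basis. -/
lemma expand (h : IsNullBasis e₁ e₂ n₁ n₂ p) (v : E52) :
    v = (-ip v e₂) • e₁ + (-ip v e₁) • e₂ + (-ip v n₂) • n₁ + (-ip v n₁) • n₂ + ip v p • p := by
  obtain ⟨x, y, z, w, u, rfl⟩ := h.exists_comb v
  obtain ⟨h1, h2, h3, h4, h5⟩ := h.ip_comb x y z w u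
  rw [h1, h2, h3, h4, h5]
  simp only [neg_neg]

end IsNullBasis

/-! ### Directional derivatives along vector fields of the plane -/

section DirD

variable {W : Type*} [NormedAddCommGroup W] [NormedSpace ℝ W]

/-- The derivative of `f` along the vector field `X`. -/
def dirD (X : Plane → Plane) (f : Plane → W) (q : Plane) : W := fderiv ℝ f q (X q)

variable {U : Set Plane} {X Y : Plane → Plane} {q : Plane}

lemma differentiableAt_of_smoothOn {f : Plane → W} (hU : IsOpen U) (hf : ContDiffOn ℝ ∞ f U)
    (hq : q ∈ U) : DifferentiableAt ℝ f q :=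
  (hf.contDiffAt (hU.mem_nhds hq)).differentiableAt (by simp)

lemma smoothOn_fderiv {f : Plane → W} (hU : IsOpen U) (hf : ContDiffOn ℝ ∞ f U) :
    ContDiffOn ℝ ∞ (fderiv ℝ f) U :=
  hf.fderiv_of_isOpen hU (by simp)

lemma smoothOn_dirD {f : Plane → W} (hU : IsOpen U) (hX : ContDiffOn ℝ ∞ X U)
    (hf : ContDiffOn ℝ ∞ f U) : ContDiffOn ℝ ∞ (dirD X f) U :=
  (smoothOn_fderiv hU hf).clm_apply hX

lemma dirD_congr {f g : Plane → W} (hU : IsOpen U) (h : EqOn f g U) (hq : q ∈ U) :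
    dirD X f q = dirD X g q := by
  have : f =ᶠ[𝓝 q] g := h.eventuallyEq_of_mem (hU.mem_nhds hq)
  simp only [dirD, this.fderiv_eq]

lemma dirD_add {f g : Plane → W} (hf : DifferentiableAt ℝ f q) (hg : DifferentiableAt ℝ g q) :
    dirD X (fun r => f r + g r) q = dirD X f q + dirD X g q := by
  simp [dirD, fderiv_fun_add hf hg]

lemma dirD_sub {f g : Plane → W} (hf : DifferentiableAt ℝ f q) (hg : DifferentiableAt ℝ g q) :
    dirD X (fun r => f r - g r) q = dirD X f q - dirD X g q := by
  simp [dirD, fderiv_fun_sub hf hg]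

lemma dirD_const (w : W) : dirD X (fun _ => w) q = 0 := by
  simp [dirD]

lemma dirD_smul {f : Plane → ℝ} {g : Plane → W} (hf : DifferentiableAt ℝ f q)
    (hg : DifferentiableAt ℝ g q) :
    dirD X (fun r => f r • g r) q = dirD X f q • g q + f q • dirD X g q := by
  simp [dirD, fderiv_fun_smul hf hg, add_comm]

lemma dirD_mul {f g : Plane → ℝ} (hf : DifferentiableAt ℝ f q)
    (hg : DifferentiableAt ℝ g q) :
    dirD X (fun r => f r * g r) q = dirD X f q * g q + f q * dirD X g q := by
  simpa using dirD_smul (X := X) hf hg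

lemma dirD_apply {f : Plane → E52} (hf : DifferentiableAt ℝ f q) (i : Fin 5) :
    dirD X (fun r => f r i) q = dirD X f q i := by
  have := ((ContinuousLinearMap.proj (R := ℝ) (φ := fun _ : Fin 5 => ℝ) i).hasFDerivAt.comp q
    hf.hasFDerivAt).fderiv
  simp only [dirD]
  erw [this]
  rfl

/-- Symmetry of the second derivative turns the bracket into a commutator of directional
derivatives, for vector-valued maps as well. -/
lemma dirD_lieBracket {f : Plane → W} (hU : IsOpen U) (hf : ContDiffOn ℝ ∞ f U)
    (hX : ContDiffOn ℝ ∞ X U) (hY : ContDiffOn ℝ ∞ Y U) (hq : q ∈ U) :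
    fderiv ℝ f q (VectorField.lieBracket ℝ X Y q) =
      dirD X (dirD Y f) q - dirD Y (dirD X f) q :=
  VectorField.fderiv_apply_lieBracket (hf.contDiffAt (hU.mem_nhds hq))
    (by rw [minSmoothness_of_isRCLikeNormedField]
        exact WithTop.coe_le_coe.2 (le_top : (2 : ℕ∞) ≤ ⊤))
    (differentiableAt_of_smoothOn hU hY hq) (differentiableAt_of_smoothOn hU hX hq)

end DirD

/-- The inner product as a continuous bilinear map. -/
def ipL : E52 →L[ℝ] E52 →L[ℝ] ℝ :=
  (LinearMap.mk₂ ℝ ip ip_add_left ip_smul_left ip_add_right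
    ip_smul_right).toContinuousBilinearMap

lemma ipL_apply (v w : E52) : ipL v w = ip v w := rfl

section

variable {U : Set Plane} {X : Plane → Plane} {q : Plane} {f g : Plane → E52}

lemma fderiv_ip (hf : DifferentiableAt ℝ f q) (hg : DifferentiableAt ℝ g q) (v : Plane) :
    fderiv ℝ (fun r => ip (f r) (g r)) q v
      = ip (fderiv ℝ f q v) (g q) + ip (f q) (fderiv ℝ g q v) := by
  have := (ipL.hasFDerivAt_of_bilinear hf.hasFDerivAt hg.hasFDerivAt).fderiv
  simp only [ipL_apply] at this
  rw [this]
  simp [ipL_apply, add_comm]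

lemma dirD_ip (hf : DifferentiableAt ℝ f q) (hg : DifferentiableAt ℝ g q) :
    dirD X (fun r => ip (f r) (g r)) q = ip (dirD X f q) (g q) + ip (f q) (dirD X g q) :=
  fderiv_ip hf hg _

lemma smoothOn_ip (hf : ContDiffOn ℝ ∞ f U) (hg : ContDiffOn ℝ ∞ g U) :
    ContDiffOn ℝ ∞ (fun r => ip (f r) (g r)) U := by
  have := ipL.isBoundedBilinearMap.contDiff (n := ∞) |>.comp_contDiffOn (hf.prodMk hg)
  exact this

end

/-! ### Adapted null frames of minimal surfaces -/

/-- The structure equations, on the open set `U`, of a minimal Lorentzian surface `F` of the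
pseudo-sphere with respect to null tangent fields `X, Y` and null normal fields `ξ, η`:
`ω` and `φ` are the components of the tangential and the normal connection forms, and
`a ξ + b η`, `c ξ + d η` are the values of the second fundamental form on `(X, X)` and `(Y, Y)`. -/
structure AdaptedFrame (F : Plane → E52) (U : Set Plane) (X Y : Plane → Plane)
    (ξ η : Plane → E52) (ω₁ ω₂ φ₁ φ₂ a b c d : Plane → ℝ) : Prop where
  isOpen : IsOpen U
  smooth_F : ContDiffOn ℝ ∞ F U
  smooth_X : ContDiffOn ℝ ∞ X U
  smooth_Y : ContDiffOn ℝ ∞ Y U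
  smooth_ξ : ContDiffOn ℝ ∞ ξ U
  smooth_η : ContDiffOn ℝ ∞ η U
  smooth_ω₁ : ContDiffOn ℝ ∞ ω₁ U
  smooth_ω₂ : ContDiffOn ℝ ∞ ω₂ U
  smooth_φ₁ : ContDiffOn ℝ ∞ φ₁ U
  smooth_φ₂ : ContDiffOn ℝ ∞ φ₂ U
  smooth_a : ContDiffOn ℝ ∞ a U
  smooth_b : ContDiffOn ℝ ∞ b U
  smooth_c : ContDiffOn ℝ ∞ c U
  smooth_d : ContDiffOn ℝ ∞ d U
  basis : ∀ q ∈ U, IsNullBasis (dirD X F q) (dirD Y F q) (ξ q) (η q) (F q)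
  dXX : ∀ q ∈ U, dirD X (dirD X F) q = ω₁ q • dirD X F q + (a q • ξ q + b q • η q)
  dYX : ∀ q ∈ U, dirD Y (dirD X F) q = ω₂ q • dirD X F q + F q
  dXY : ∀ q ∈ U, dirD X (dirD Y F) q = -(ω₁ q • dirD Y F q) + F q
  dYY : ∀ q ∈ U, dirD Y (dirD Y F) q = -(ω₂ q • dirD Y F q) + (c q • ξ q + d q • η q)
  dXξ : ∀ q ∈ U, dirD X ξ q = φ₁ q • ξ q - b q • dirD Y F q
  dYξ : ∀ q ∈ U, dirD Y ξ q = φ₂ q • ξ q - d q • dirD X F q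
  dXη : ∀ q ∈ U, dirD X η q = -(φ₁ q • η q) - a q • dirD Y F q
  dYη : ∀ q ∈ U, dirD Y η q = -(φ₂ q • η q) - c q • dirD X F q

/-- A vector of the plane in terms of two null vectors for the induced metric. -/
lemma eq_comb_of_null {F : Plane → E52} {q X Y : Plane} (h₁₁ : inducedMetric F q X X = 0)
    (h₁₂ : inducedMetric F q X Y = -1) (h₂₂ : inducedMetric F q Y Y = 0) (v : Plane) :
    v = (-inducedMetric F q v Y) • X + (-inducedMetric F q v X) • Y := by
  have h₂₁ : inducedMetric F q Y X = -1 := by rw [← h₁₂]; exact ip_comm _ _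
  have key : ∀ x y : ℝ, inducedMetric F q (x • X + y • Y) X = -y ∧
      inducedMetric F q (x • X + y • Y) Y = -x := by
    intro x y
    unfold inducedMetric at *
    simp only [map_add, map_smul, ip_add_left, ip_smul_left, h₁₁, h₁₂, h₂₁, h₂₂]
    constructor <;> ring
  have hli : LinearIndependent ℝ ![X, Y] := by
    rw [LinearIndependent.pair_iff]
    intro x y hxy
    obtain ⟨h1, h2⟩ := key x y
    rw [hxy] at h1 h2
    simp only [inducedMetric, map_zero, ip_zero_left] at h1 h2
    exact ⟨by linarith, by linarith⟩
  have hspan := hli.span_eq_top_of_card_eq_finrank (by simp)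
  have hv : v ∈ Submodule.span ℝ (range ![X, Y]) := by rw [hspan]; trivial
  obtain ⟨g, rfl⟩ := (Submodule.mem_span_range_iff_exists_fun ℝ).1 hv
  rw [Fin.sum_univ_two]
  obtain ⟨h1, h2⟩ := key (g 0) (g 1)
  simp only [Matrix.cons_val_zero, Matrix.cons_val_one] at *
  rw [h1, h2, neg_neg, neg_neg]

/-! ### Gauss, Codazzi and Ricci equations, and their consequences for constant `a d` and `b c`. -/

namespace AdaptedFrame

variable {F : Plane → E52} {U : Set Plane} {X Y : Plane → Plane}
    {ξ η : Plane → E52} {ω₁ ω₂ φ₁ φ₂ a b c d : Plane → ℝ}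

lemma mono (h : AdaptedFrame F U X Y ξ η ω₁ ω₂ φ₁ φ₂ a b c d) {V : Set Plane} (hV : IsOpen V)
    (hVU : V ⊆ U) : AdaptedFrame F V X Y ξ η ω₁ ω₂ φ₁ φ₂ a b c d :=
  ⟨hV, h.smooth_F.mono hVU, h.smooth_X.mono hVU, h.smooth_Y.mono hVU, h.smooth_ξ.mono hVU,
    h.smooth_η.mono hVU, h.smooth_ω₁.mono hVU, h.smooth_ω₂.mono hVU, h.smooth_φ₁.mono hVU,
    h.smooth_φ₂.mono hVU, h.smooth_a.mono hVU, h.smooth_b.mono hVU, h.smooth_c.mono hVU,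
    h.smooth_d.mono hVU, fun q hq => h.basis q (hVU hq), fun q hq => h.dXX q (hVU hq),
    fun q hq => h.dYX q (hVU hq), fun q hq => h.dXY q (hVU hq), fun q hq => h.dYY q (hVU hq),
    fun q hq => h.dXξ q (hVU hq), fun q hq => h.dYξ q (hVU hq), fun q hq => h.dXη q (hVU hq),
    fun q hq => h.dYη q (hVU hq)⟩

/-- Exchanging the two normal fields. -/
lemma swap_normal (h : AdaptedFrame F U X Y ξ η ω₁ ω₂ φ₁ φ₂ a b c d) :
    AdaptedFrame F U X Y η ξ ω₁ ω₂ (-φ₁) (-φ₂) b a d c where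
  isOpen := h.isOpen
  smooth_F := h.smooth_F
  smooth_X := h.smooth_X
  smooth_Y := h.smooth_Y
  smooth_ξ := h.smooth_η
  smooth_η := h.smooth_ξ
  smooth_ω₁ := h.smooth_ω₁
  smooth_ω₂ := h.smooth_ω₂
  smooth_φ₁ := h.smooth_φ₁.neg
  smooth_φ₂ := h.smooth_φ₂.neg
  smooth_a := h.smooth_b
  smooth_b := h.smooth_a
  smooth_c := h.smooth_d
  smooth_d := h.smooth_c
  basis q hq := (h.basis q hq).swap_normal
  dXX q hq := by rw [h.dXX q hq]; module
  dYX := h.dYX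
  dXY := h.dXY
  dYY q hq := by rw [h.dYY q hq]; module
  dXξ q hq := by rw [h.dXη q hq, Pi.neg_apply]; module
  dYξ q hq := by rw [h.dYη q hq, Pi.neg_apply]; module
  dXη q hq := by rw [h.dXξ q hq, Pi.neg_apply]; module
  dYη q hq := by rw [h.dYξ q hq, Pi.neg_apply]; module

/-- Exchanging the two tangent fields and the two normal fields. -/
lemma swap_tangent (h : AdaptedFrame F U X Y ξ η ω₁ ω₂ φ₁ φ₂ a b c d) :
    AdaptedFrame F U Y X η ξ (-ω₂) (-ω₁) (-φ₂) (-φ₁) d c b a where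
  isOpen := h.isOpen
  smooth_F := h.smooth_F
  smooth_X := h.smooth_Y
  smooth_Y := h.smooth_X
  smooth_ξ := h.smooth_η
  smooth_η := h.smooth_ξ
  smooth_ω₁ := h.smooth_ω₂.neg
  smooth_ω₂ := h.smooth_ω₁.neg
  smooth_φ₁ := h.smooth_φ₂.neg
  smooth_φ₂ := h.smooth_φ₁.neg
  smooth_a := h.smooth_d
  smooth_b := h.smooth_c
  smooth_c := h.smooth_b
  smooth_d := h.smooth_a
  basis q hq := (h.basis q hq).swap_normal.swap_tangent
  dXX q hq := by rw [h.dYY q hq, Pi.neg_apply]; module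
  dYX q hq := by rw [h.dXY q hq, Pi.neg_apply]; module
  dXY q hq := by rw [h.dYX q hq, Pi.neg_apply]; module
  dYY q hq := by rw [h.dXX q hq, Pi.neg_apply]; module
  dXξ q hq := by rw [h.dYη q hq, Pi.neg_apply]; module
  dYξ q hq := by rw [h.dXη q hq, Pi.neg_apply]; module
  dXη q hq := by rw [h.dYξ q hq, Pi.neg_apply]; module
  dYη q hq := by rw [h.dXξ q hq, Pi.neg_apply]; module

variable {q : Plane}

lemma field_expand (h : AdaptedFrame F U X Y ξ η ω₁ ω₂ φ₁ φ₂ a b c d) (hq : q ∈ U) (v : Plane) :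
    v = (-inducedMetric F q v (Y q)) • X q + (-inducedMetric F q v (X q)) • Y q :=
  eq_comb_of_null (h.basis q hq).e₁₁ (h.basis q hq).e₁₂ (h.basis q hq).e₂₂ v

/-- A plane vector is determined by the products of its image with `dF(X)` and `dF(Y)`. The image of
the bracket is the difference of the two mixed structure equations, in which the position terms
cancel. -/
lemma lieBracket_eq (h : AdaptedFrame F U X Y ξ η ω₁ ω₂ φ₁ φ₂ a b c d) (hq : q ∈ U) :
    VectorField.lieBracket ℝ X Y q = (-ω₂ q) • X q + (-ω₁ q) • Y q := by
  have B := h.basis q hq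
  have h1 := dirD_lieBracket h.isOpen h.smooth_F h.smooth_X h.smooth_Y hq
  rw [h.dXY q hq, h.dYX q hq] at h1
  have h2 := h.field_expand hq (VectorField.lieBracket ℝ X Y q)
  have e1 : inducedMetric F q (VectorField.lieBracket ℝ X Y q) (Y q) = ω₂ q := by
    unfold inducedMetric
    rw [h1, show fderiv ℝ F q (Y q) = dirD Y F q from rfl]
    simp only [ip_sub_left, ip_add_left, ip_neg_left, ip_smul_left, B.e₂₂, B.e₁₂, B.pe₂]
    ring
  have e2 : inducedMetric F q (VectorField.lieBracket ℝ X Y q) (X q) = ω₁ q := by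
    unfold inducedMetric
    rw [h1, show fderiv ℝ F q (X q) = dirD X F q from rfl]
    simp only [ip_sub_left, ip_add_left, ip_neg_left, ip_smul_left, B.e₂₁, B.e₁₁, B.pe₁]
    ring
  rw [e1, e2] at h2
  exact h2

/-- The single integrability condition behind all that follows: it is applied to `dF(X)`, to `ξ`, to
`a`, and later to the coordinate `t`. -/
lemma dirD_comm {W : Type*} [NormedAddCommGroup W] [NormedSpace ℝ W]
    (h : AdaptedFrame F U X Y ξ η ω₁ ω₂ φ₁ φ₂ a b c d) (hq : q ∈ U) {f : Plane → W}
    (hf : ContDiffOn ℝ ∞ f U) :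
    dirD X (dirD Y f) q - dirD Y (dirD X f) q
      = (-ω₂ q) • dirD X f q + (-ω₁ q) • dirD Y f q := by
  rw [← dirD_lieBracket h.isOpen hf h.smooth_X h.smooth_Y hq, h.lieBracket_eq hq, map_add,
    map_smul, map_smul]
  rfl

/-- The Codazzi and Gauss equations, from the commutator on `dF(X)`. -/
lemma codazzi_gauss (h : AdaptedFrame F U X Y ξ η ω₁ ω₂ φ₁ φ₂ a b c d) (hq : q ∈ U) :
    dirD Y a q = (2 * ω₂ q - φ₂ q) * a q ∧ dirD Y b q = (2 * ω₂ q + φ₂ q) * b q ∧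
      dirD X ω₂ q - dirD Y ω₁ q + 2 * ω₁ q * ω₂ q = -(1 + a q * d q + b q * c q) := by
  have hU := h.isOpen
  have D {W : Type} [NormedAddCommGroup W] [NormedSpace ℝ W] {f : Plane → W}
    (hf : ContDiffOn ℝ ∞ f U) := differentiableAt_of_smoothOn hU hf hq
  have sE := smoothOn_dirD hU h.smooth_X h.smooth_F
  have h1 := h.dirD_comm hq sE
  rw [dirD_congr hU (f := dirD Y (dirD X F)) h.dYX hq,
    dirD_congr hU (f := dirD X (dirD X F)) h.dXX hq,
    ← sub_eq_zero] at h1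
  have := D sE
  have := D h.smooth_F
  have := D h.smooth_ξ
  have := D h.smooth_η
  have := D h.smooth_ω₁
  have := D h.smooth_ω₂
  have := D h.smooth_a
  have := D h.smooth_b
  simp (disch := fun_prop) only [dirD_add, dirD_smul, h.dXX q hq, h.dYX q hq, h.dYξ q hq,
    h.dYη q hq] at h1
  -- The coefficient of `dF(X)` is the Gauss equation, those of `ξ` and `η` are the Codazzi
  -- equations; the other two cancel identically.
  obtain ⟨r1, r2, r3, r4, r5⟩ := (h.basis q hq).coeff_eq_zero
    (x := dirD X ω₂ q - dirD Y ω₁ q + 2 * ω₁ q * ω₂ q + (1 + a q * d q + b q * c q)) (y := 0)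
    (z := (2 * ω₂ q - φ₂ q) * a q - dirD Y a q) (w := (2 * ω₂ q + φ₂ q) * b q - dirD Y b q)
    (u := 0) (by rw [← h1]; module)
  exact ⟨by linarith, by linarith, by linarith⟩

/-- In the frame with both pairs exchanged, `c` takes the place of `b`. -/
lemma codazzi_c (h : AdaptedFrame F U X Y ξ η ω₁ ω₂ φ₁ φ₂ a b c d) (hq : q ∈ U) :
    dirD X c q = -(2 * ω₁ q + φ₁ q) * c q := by
  have := (h.swap_tangent.codazzi_gauss hq).2.1
  simp only [Pi.neg_apply] at this
  linarith

lemma codazzi_d (h : AdaptedFrame F U X Y ξ η ω₁ ω₂ φ₁ φ₂ a b c d) (hq : q ∈ U) :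
    dirD X d q = -(2 * ω₁ q - φ₁ q) * d q := by
  have := (h.swap_tangent.codazzi_gauss hq).1
  simp only [Pi.neg_apply] at this
  linarith

/-- The Ricci equation. -/
lemma ricci (h : AdaptedFrame F U X Y ξ η ω₁ ω₂ φ₁ φ₂ a b c d) (hq : q ∈ U) :
    dirD X φ₂ q - dirD Y φ₁ q + ω₂ q * φ₁ q + ω₁ q * φ₂ q = a q * d q - b q * c q := by
  have hU := h.isOpen
  have D {W : Type} [NormedAddCommGroup W] [NormedSpace ℝ W] {f : Plane → W}
    (hf : ContDiffOn ℝ ∞ f U) := differentiableAt_of_smoothOn hU hf hq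
  have sE := smoothOn_dirD hU h.smooth_X h.smooth_F
  have sE' := smoothOn_dirD hU h.smooth_Y h.smooth_F
  have h1 := h.dirD_comm hq h.smooth_ξ
  rw [dirD_congr hU (f := dirD Y ξ) h.dYξ hq, dirD_congr hU (f := dirD X ξ) h.dXξ hq,
    ← sub_eq_zero] at h1
  have := D sE
  have := D sE'
  have := D h.smooth_ξ
  have := D h.smooth_φ₁
  have := D h.smooth_φ₂
  have := D h.smooth_b
  have := D h.smooth_d
  simp (disch := fun_prop) only [dirD_sub, dirD_smul, h.dXX q hq, h.dYY q hq, h.dYξ q hq,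
    h.dXξ q hq] at h1
  obtain ⟨r1, r2, r3, r4, r5⟩ := (h.basis q hq).coeff_eq_zero
    (x := φ₁ q * d q - dirD X d q - d q * ω₁ q - ω₁ q * d q)
    (y := -(φ₂ q * b q) + dirD Y b q - b q * ω₂ q - ω₂ q * b q)
    (z := dirD X φ₂ q - dirD Y φ₁ q + ω₂ q * φ₁ q + ω₁ q * φ₂ q - (a q * d q - b q * c q))
    (w := 0) (u := 0) (by rw [← h1]; module)
  linarith

/-- The remaining derivative of `a` is determined if the constant `a d` does not vanish. -/
lemma dirD_X_a (h : AdaptedFrame F U X Y ξ η ω₁ ω₂ φ₁ φ₂ a b c d) {P : ℝ} (hP : P ≠ 0)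
    (had : ∀ q ∈ U, a q * d q = P) (hq : q ∈ U) :
    dirD X a q = (2 * ω₁ q - φ₁ q) * a q := by
  have hU := h.isOpen
  -- Codazzi controls only `Y a` and `X d`; differentiating the constant product converts `X d` into
  -- `X a`.
  have h1 : dirD X (fun r => a r * d r) q = dirD X (fun _ => P) q := dirD_congr hU had hq
  rw [dirD_mul (differentiableAt_of_smoothOn hU h.smooth_a hq)
    (differentiableAt_of_smoothOn hU h.smooth_d hq), dirD_const, h.codazzi_d hq] at h1
  have hd : d q ≠ 0 := fun h0 => hP (by rw [← had q hq, h0, mul_zero])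
  have : (dirD X a q - (2 * ω₁ q - φ₁ q) * a q) * d q = 0 := by linarith
  rcases mul_eq_zero.1 this with h2 | h2
  · linarith
  · exact absurd h2 hd

/-- If the constant `a d` does not vanish, the curvatures are related by `2 K = -K^D`. -/
lemma curvature_relation (h : AdaptedFrame F U X Y ξ η ω₁ ω₂ φ₁ φ₂ a b c d) {P : ℝ} (hP : P ≠ 0)
    (had : ∀ q ∈ U, a q * d q = P) (hq : q ∈ U) :
    2 * (1 + a q * d q + b q * c q) = -(a q * d q - b q * c q) := by
  have hU := h.isOpen
  have D {W : Type} [NormedAddCommGroup W] [NormedSpace ℝ W] {f : Plane → W}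
    (hf : ContDiffOn ℝ ∞ f U) := differentiableAt_of_smoothOn hU hf hq
  have hX : ∀ r ∈ U, dirD X a r = (2 * ω₁ r - φ₁ r) * a r := fun r hr => h.dirD_X_a hP had hr
  have hY : ∀ r ∈ U, dirD Y a r = (2 * ω₂ r - φ₂ r) * a r := fun r hr => (h.codazzi_gauss hr).1
  have := D h.smooth_a
  have := D h.smooth_ω₁
  have := D h.smooth_ω₂
  have := D h.smooth_φ₁
  have := D h.smooth_φ₂
  -- Both derivatives of `a` have the form `(2 ω - φ) a`. As `a` has no zeros, `2 ω - φ` is a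
  -- logarithmic differential, hence closed; its exterior derivative is twice the Gauss equation
  -- minus the Ricci equation.
  have h1 := h.dirD_comm hq h.smooth_a
  rw [dirD_congr hU (f := dirD Y a) hY hq, dirD_congr hU (f := dirD X a) hX hq] at h1
  simp (disch := fun_prop) only [dirD_mul, dirD_sub, dirD_const, hX q hq, hY q hq,
    smul_eq_mul] at h1
  have ha : a q ≠ 0 := fun h0 => hP (by rw [← had q hq, h0, zero_mul])
  have h2 := h.ricci hq
  have h3 := (h.codazzi_gauss hq).2.2
  have : (2 * (dirD X ω₂ q - dirD Y ω₁ q + 2 * ω₁ q * ω₂ q)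
      - (dirD X φ₂ q - dirD Y φ₁ q + ω₂ q * φ₁ q + ω₁ q * φ₂ q)) * a q = 0 := by linarith
  rcases mul_eq_zero.1 this with h4 | h4
  · linarith
  · exact absurd h4 ha

/-- `a d` and `b c` cannot both be non-zero constants, unless they coincide. -/
lemma mul_eq_zero_of_const (h : AdaptedFrame F U X Y ξ η ω₁ ω₂ φ₁ φ₂ a b c d) {P Q : ℝ}
    (had : ∀ q ∈ U, a q * d q = P) (hbc : ∀ q ∈ U, b q * c q = Q) (hPQ : P ≠ Q) (hq : q ∈ U) :
    P = 0 ∨ Q = 0 := by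
  by_contra! hne
  have h1 := h.curvature_relation hne.1 had hq
  -- Exchanging `ξ` and `η` interchanges `a d` and `b c`, so the same relation returns with the
  -- opposite sign on the right.
  have h2 := h.swap_normal.curvature_relation hne.2 hbc hq
  rw [had q hq, hbc q hq] at h1 h2
  exact hPQ (by linarith)

end AdaptedFrame

/-! ### The definitions of the curvatures in an adapted frame -/

lemma IsNullBasis.eq_comb {e₁ e₂ n₁ n₂ p : E52} (h : IsNullBasis e₁ e₂ n₁ n₂ p) {v : E52}
    {x y z w u : ℝ} (hx : ip v e₂ = -x) (hy : ip v e₁ = -y) (hz : ip v n₂ = -z)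
    (hw : ip v n₁ = -w) (hu : ip v p = u) :
    v = x • e₁ + y • e₂ + z • n₁ + w • n₂ + u • p := by
  have := h.expand v
  rw [hx, hy, hz, hw, hu, neg_neg, neg_neg, neg_neg, neg_neg] at this
  exact this

lemma eq_sum_basisVec (v : Plane) : v = v 0 • basisVec 0 + v 1 • basisVec 1 := by
  ext i
  fin_cases i <;> simp [basisVec]

lemma fderiv_eq_sum_pd {W : Type*} [NormedAddCommGroup W] [NormedSpace ℝ W] (f : Plane → W)
    (q v : Plane) : fderiv ℝ f q v = v 0 • pd 0 f q + v 1 • pd 1 f q := by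
  conv_lhs => rw [eq_sum_basisVec v]
  rw [map_add, map_smul, map_smul]
  rfl

/-- The second derivative of `F`. -/
def hess (F : Plane → E52) (q v w : Plane) : E52 := fderiv ℝ (fderiv ℝ F) q v w

lemma hess_add_left (F : Plane → E52) (q u v w : Plane) :
    hess F q (u + v) w = hess F q u w + hess F q v w := by simp [hess]

lemma hess_add_right (F : Plane → E52) (q u v w : Plane) :
    hess F q u (v + w) = hess F q u v + hess F q u w := by simp [hess]

lemma hess_smul_left (F : Plane → E52) (q v w : Plane) (c : ℝ) :
    hess F q (c • v) w = c • hess F q v w := by simp [hess]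

lemma hess_smul_right (F : Plane → E52) (q v w : Plane) (c : ℝ) :
    hess F q v (c • w) = c • hess F q v w := by simp [hess]

/-! ### The coordinate Levi-Civita connection as a tangential derivative. -/

section

variable {F : Plane → E52} {U : Set Plane} {q : Plane}

lemma hess_comm (hU : IsOpen U) (hF : ContDiffOn ℝ ∞ F U) (hq : q ∈ U) (v w : Plane) :
    hess F q v w = hess F q w v :=
  (hF.contDiffAt (hU.mem_nhds hq)).isSymmSndFDerivAt
    (by rw [minSmoothness_of_isRCLikeNormedField]
        exact WithTop.coe_le_coe.2 (le_top : (2 : ℕ∞) ≤ ⊤)) v w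

lemma fderiv_fderiv_apply (hU : IsOpen U) (hF : ContDiffOn ℝ ∞ F U) {Z : Plane → Plane}
    (hZ : DifferentiableAt ℝ Z q) (hq : q ∈ U) (v : Plane) :
    fderiv ℝ (fun r => fderiv ℝ F r (Z r)) q v
      = hess F q v (Z q) + fderiv ℝ F q (fderiv ℝ Z q v) := by
  have h1 := differentiableAt_of_smoothOn hU (smoothOn_fderiv hU hF) hq
  rw [fderiv_clm_apply h1 hZ]
  simp [hess, add_comm]

lemma pd_pd (hU : IsOpen U) (hF : ContDiffOn ℝ ∞ F U) (hq : q ∈ U) (i j : Fin 2) :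
    pd i (pd j F) q = hess F q (basisVec i) (basisVec j) := by
  have := fderiv_fderiv_apply hU hF (Z := fun _ => basisVec j) (by fun_prop) hq (basisVec i)
  rw [show fderiv ℝ (fun _ : Plane => basisVec j) q (basisVec i) = 0 by simp, map_zero,
    add_zero] at this
  exact this

/-- The inverse of the matrix of the induced metric, from two null vectors. -/
lemma gram_inv {X Y : Plane} (h₁₁ : inducedMetric F q X X = 0)
    (h₁₂ : inducedMetric F q X Y = -1) (h₂₂ : inducedMetric F q Y Y = 0) :
    gram F q * Matrix.of (fun i j => -(X i * Y j + Y i * X j)) = 1 := by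
  have hX := eq_comb_of_null h₁₁ h₁₂ h₂₂
  ext i k
  have h1 : inducedMetric F q (basisVec i) X = X 0 * gram F q i 0 + X 1 * gram F q i 1 := by
    unfold inducedMetric
    rw [fderiv_eq_sum_pd F q X, ip_add_right, ip_smul_right, ip_smul_right]
    rfl
  have h2 : inducedMetric F q (basisVec i) Y = Y 0 * gram F q i 0 + Y 1 * gram F q i 1 := by
    unfold inducedMetric
    rw [fderiv_eq_sum_pd F q Y, ip_add_right, ip_smul_right, ip_smul_right]
    rfl
  have h3 := congrArg (fun v : Plane => v k) (hX (basisVec i))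
  simp only [PiLp.add_apply, PiLp.smul_apply, smul_eq_mul, h1, h2] at h3
  have h4 : (1 : Matrix (Fin 2) (Fin 2) ℝ) i k = basisVec i k := by
    simp [basisVec, Matrix.one_apply, eq_comm]
  rw [h4, h3, Matrix.mul_apply, Fin.sum_univ_two]
  simp only [Matrix.of_apply]
  ring

lemma pd_gram (hU : IsOpen U) (hF : ContDiffOn ℝ ∞ F U) (hq : q ∈ U) (i j l : Fin 2) :
    pd i (fun r => gram F r j l) q = ip (hess F q (basisVec i) (basisVec j)) (pd l F q)
      + ip (pd j F q) (hess F q (basisVec i) (basisVec l)) := by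
  have h1 := differentiableAt_of_smoothOn hU (smoothOn_fderiv hU hF) hq
  have h2 : ∀ j, DifferentiableAt ℝ (pd j F) q := fun j => by
    unfold pd
    fun_prop
  rw [← pd_pd hU hF hq, ← pd_pd hU hF hq]
  exact fderiv_ip (h2 j) (h2 l) (basisVec i)

/-- The Christoffel symbols with lowered index are the products `⟨∂_i ∂_j F, ∂_l F⟩`. -/
lemma sum_gram_christoffel (hU : IsOpen U) (hF : ContDiffOn ℝ ∞ F U) (hq : q ∈ U)
    (hG : IsUnit (gram F q).det) (i j l : Fin 2) :
    ∑ k, gram F q l k * christoffel F k i j q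
      = ip (hess F q (basisVec i) (basisVec j)) (pd l F q) := by
  set S : Fin 2 → ℝ := fun l => pd i (fun r => gram F r j l) q + pd j (fun r => gram F r i l) q
      - pd l (fun r => gram F r i j) q with hS
  have h1 : (fun k => christoffel F k i j q) = (1 / 2 : ℝ) • ((gram F q)⁻¹.mulVec S) := by
    ext k
    rfl
  have h2 : (gram F q).mulVec (fun k => christoffel F k i j q) = (1 / 2 : ℝ) • S := by
    rw [h1, Matrix.mulVec_smul, Matrix.mulVec_mulVec, Matrix.mul_nonsing_inv _ hG,
      Matrix.one_mulVec]
  have h3 := congrFun h2 l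
  simp only [Pi.smul_apply, smul_eq_mul, hS, pd_gram hU hF hq] at h3
  -- Koszul cancellation: by symmetry of the second derivative, four of the six products cancel and
  -- the other two coincide.
  rw [hess_comm hU hF hq (basisVec j) (basisVec i), hess_comm hU hF hq (basisVec l) (basisVec i),
    hess_comm hU hF hq (basisVec l) (basisVec j), ip_comm (pd j F q), ip_comm (pd i F q)] at h3
  refine Eq.trans ?_ (h3.trans ?_)
  · rfl
  · ring

/-- The Levi-Civita connection is the tangential part of the derivative in `𝔼⁵₂`. -/
lemma ip_fderiv_leviCivita (hU : IsOpen U) (hF : ContDiffOn ℝ ∞ F U) (hq : q ∈ U)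
    (hG : IsUnit (gram F q).det) (A : Plane → Plane) {Z : Plane → Plane}
    (hZ : DifferentiableAt ℝ Z q) (v : Plane) :
    ip (fderiv ℝ F q (leviCivita F A Z q)) (fderiv ℝ F q v)
      = ip (fderiv ℝ (fun r => fderiv ℝ F r (Z r)) q (A q)) (fderiv ℝ F q v) := by
  have key : ∀ l : Fin 2, ip (fderiv ℝ F q (leviCivita F A Z q)) (pd l F q)
      = ip (fderiv ℝ (fun r => fderiv ℝ F r (Z r)) q (A q)) (pd l F q) := by
    intro l
    have hc : ∀ k, fderiv ℝ (fun r => Z r k) q (A q) = (fderiv ℝ Z q (A q)) k := by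
      intro k
      have := ((EuclideanSpace.proj (𝕜 := ℝ) k).hasFDerivAt.comp q hZ.hasFDerivAt).fderiv
      erw [this]
      rfl
    rw [fderiv_fderiv_apply hU hF hZ hq, fderiv_eq_sum_pd F q (leviCivita F A Z q),
      fderiv_eq_sum_pd F q (fderiv ℝ Z q (A q))]
    have hh : hess F q (A q) (Z q) = ∑ i, ∑ j, (A q i * Z q j) •
        hess F q (basisVec i) (basisVec j) := by
      conv_lhs => rw [eq_sum_basisVec (A q), eq_sum_basisVec (Z q)]
      simp only [hess_add_left, hess_add_right, hess_smul_left, hess_smul_right, Fin.sum_univ_two]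
      module
    have hs := sum_gram_christoffel hU hF hq hG
    simp only [Fin.sum_univ_two] at hs hh
    rw [hh]
    simp only [leviCivita, hc, ip_add_left, ip_smul_left, Fin.sum_univ_two, ← hs]
    have hg : ∀ k, ip (pd k F q) (pd l F q) = gram F q l k := fun k => ip_comm _ _
    simp only [hg]
    ring
  rw [fderiv_eq_sum_pd F q v, ip_add_right, ip_add_right, ip_smul_right, ip_smul_right,
    ip_smul_right, ip_smul_right, key, key]

/-- Only the germ of the differentiated field matters, so inside the curvature tensor the inner
covariant derivative may be replaced by a field known to be smooth. -/
lemma leviCivita_congr {A Z Z' : Plane → Plane} (hU : IsOpen U) (h : EqOn Z Z' U) (hq : q ∈ U) :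
    leviCivita F A Z q = leviCivita F A Z' q := by
  unfold leviCivita
  congr 1
  ext k
  rw [h hq]
  congr 2
  have : (fun r => Z r k) =ᶠ[𝓝 q] (fun r => Z' r k) := by
    filter_upwards [hU.mem_nhds hq] with r hr
    rw [h hr]
  rw [this.fderiv_eq]

end

/-! ### Normal projection and normal curvature in an adapted frame. -/

namespace AdaptedFrame

variable {F : Plane → E52} {U : Set Plane} {X Y : Plane → Plane}
    {ξ η : Plane → E52} {ω₁ ω₂ φ₁ φ₂ a b c d : Plane → ℝ} {q : Plane}

lemma gram_mul (h : AdaptedFrame F U X Y ξ η ω₁ ω₂ φ₁ φ₂ a b c d) (hq : q ∈ U) :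
    gram F q * Matrix.of (fun i j => -(X q i * Y q j + Y q i * X q j)) = 1 :=
  gram_inv (h.basis q hq).e₁₁ (h.basis q hq).e₁₂ (h.basis q hq).e₂₂

lemma isUnit_gram_det (h : AdaptedFrame F U X Y ξ η ω₁ ω₂ φ₁ φ₂ a b c d) (hq : q ∈ U) :
    IsUnit (gram F q).det :=
  Matrix.isUnit_det_of_right_inverse (h.gram_mul hq)

/-- The inverse Gram matrix is expressed by the null pair, so the double sum is the tangential part
of the expansion in the null basis. -/
lemma normalProj_eq (h : AdaptedFrame F U X Y ξ η ω₁ ω₂ φ₁ φ₂ a b c d) (hq : q ∈ U) (v : E52) :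
    normalProj F q v = (-ip v (η q)) • ξ q + (-ip v (ξ q)) • η q := by
  have hi := Matrix.inv_eq_right_inv (h.gram_mul hq)
  have hv := (h.basis q hq).expand v
  have hX : dirD X F q = X q 0 • pd 0 F q + X q 1 • pd 1 F q := fderiv_eq_sum_pd F q (X q)
  have hY : dirD Y F q = Y q 0 • pd 0 F q + Y q 1 • pd 1 F q := fderiv_eq_sum_pd F q (Y q)
  have hsum : ∑ i, ∑ j, ((gram F q)⁻¹ i j * ip v (pd i F q)) • pd j F q
      = (-ip v (dirD Y F q)) • dirD X F q + (-ip v (dirD X F q)) • dirD Y F q := by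
    rw [hi, hX, hY]
    simp only [Fin.sum_univ_two, Matrix.of_apply, ip_add_right, ip_smul_right]
    module
  unfold normalProj
  rw [hsum]
  nth_rewrite 1 [hv]
  module

/-- The second derivative differs from the structure equations by `dF` of the derivatives of `X` and
`Y`, which are tangent and absorbed in `w`. The mixed terms contribute only the position vector;
this is where minimality enters. -/
lemma hess_normal (h : AdaptedFrame F U X Y ξ η ω₁ ω₂ φ₁ φ₂ a b c d) (hq : q ∈ U) (u v u' v' : ℝ) :
    ∃ w, hess F q (u • X q + v • Y q) (u' • X q + v' • Y q) = fderiv ℝ F q w +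
      ((u * u') • (a q • ξ q + b q • η q) + (u * v' + v * u') • F q
        + (v * v') • (c q • ξ q + d q • η q)) := by
  have hX := differentiableAt_of_smoothOn h.isOpen h.smooth_X hq
  have hY := differentiableAt_of_smoothOn h.isOpen h.smooth_Y hq
  have h1 := fderiv_fderiv_apply h.isOpen h.smooth_F hX hq (X q)
  have h2 := fderiv_fderiv_apply h.isOpen h.smooth_F hY hq (X q)
  have h3 := fderiv_fderiv_apply h.isOpen h.smooth_F hY hq (Y q)
  have h1' := (h.dXX q hq).symm.trans h1
  have h2' := (h.dXY q hq).symm.trans h2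
  have h3' := (h.dYY q hq).symm.trans h3
  rw [hess_add_left, hess_add_right, hess_add_right]
  simp only [hess_smul_left, hess_smul_right]
  rw [hess_comm h.isOpen h.smooth_F hq (Y q) (X q), ← sub_eq_iff_eq_add.2 h1',
    ← sub_eq_iff_eq_add.2 h2', ← sub_eq_iff_eq_add.2 h3']
  refine ⟨(u * u') • (ω₁ q • X q - fderiv ℝ X q (X q))
    + (u * v' + v * u') • (-(ω₁ q) • Y q - fderiv ℝ Y q (X q))
    + (v * v') • (-(ω₂ q) • Y q - fderiv ℝ Y q (Y q)), ?_⟩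
  simp only [map_add, map_sub, map_smul, dirD]
  module

lemma ip_fderiv_normal (h : AdaptedFrame F U X Y ξ η ω₁ ω₂ φ₁ φ₂ a b c d) (hq : q ∈ U)
    (w : Plane) : ip (fderiv ℝ F q w) (ξ q) = 0 ∧ ip (fderiv ℝ F q w) (η q) = 0 ∧
      ip (fderiv ℝ F q w) (F q) = 0 := by
  have B := h.basis q hq
  have hw := congrArg (fderiv ℝ F q) (h.field_expand hq w)
  rw [map_add, map_smul, map_smul] at hw
  rw [hw]
  have e1 : fderiv ℝ F q (X q) = dirD X F q := rfl
  have e2 : fderiv ℝ F q (Y q) = dirD Y F q := rfl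
  rw [e1, e2]
  simp only [ip_add_left, ip_smul_left, B.en₁₁, B.en₂₁, B.en₁₂, B.en₂₂, B.ep₁, B.ep₂]
  simp

/-- A decomposition of a vector into a tangential and a normal part is unique. -/
lemma eq_of_tangent_normal (h : AdaptedFrame F U X Y ξ η ω₁ ω₂ φ₁ φ₂ a b c d) (hq : q ∈ U)
    {v w w' n : E52} {s : Plane} (hv : v = fderiv ℝ F q s + n)
    (hn : ∀ r, ip n (fderiv ℝ F q r) = 0) {t : Plane} (hw' : w' = fderiv ℝ F q t)
    (ht : ∀ r, ip w' (fderiv ℝ F q r) = ip v (fderiv ℝ F q r)) (hw : w = v - w') : w = n := by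
  have h1 : ∀ r, inducedMetric F q (t - s) r = 0 := by
    intro r
    have := ht r
    rw [hv, hw', ip_add_left, hn] at this
    unfold inducedMetric
    rw [map_sub, ip_sub_left]
    linarith
  have h2 := h.field_expand hq (t - s)
  rw [h1, h1] at h2
  have h3 : t = s := by
    rw [← sub_eq_zero, h2]
    simp
  rw [hw, hv, hw', h3]
  abel

/-- The definition of the normal curvature in an adapted frame. -/
lemma normalCurv_eq (h : AdaptedFrame F U X Y ξ η ω₁ ω₂ φ₁ φ₂ a b c d) (hq : q ∈ U) :
    -ip (normalCurvTensor F X Y ξ q) (η q) = a q * d q - b q * c q := by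
  have hU := h.isOpen
  have B := h.basis q hq
  have e1 : EqOn (normalConn F Y ξ) (fun r => φ₂ r • ξ r) U := by
    intro r hr
    have B := h.basis r hr
    have : fderiv ℝ ξ r (Y r) = φ₂ r • ξ r - d r • dirD X F r := h.dYξ r hr
    simp only [normalConn, this, h.normalProj_eq hr, ip_sub_left, ip_smul_left, B.n₁₁, B.n₁₂,
      B.en₁₁, B.en₁₂]
    module
  have e2 : EqOn (normalConn F X ξ) (fun r => φ₁ r • ξ r) U := by
    intro r hr
    have B := h.basis r hr
    have : fderiv ℝ ξ r (X r) = φ₁ r • ξ r - b r • dirD Y F r := h.dXξ r hr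
    simp only [normalConn, this, h.normalProj_eq hr, ip_sub_left, ip_smul_left, B.n₁₁, B.n₁₂,
      B.en₂₁, B.en₂₂]
    module
  have hξ := differentiableAt_of_smoothOn hU h.smooth_ξ hq
  have h1 : normalConn F X (normalConn F Y ξ) q
      = normalProj F q (dirD X φ₂ q • ξ q + φ₂ q • dirD X ξ q) := by
    rw [← dirD_smul (differentiableAt_of_smoothOn hU h.smooth_φ₂ hq) hξ,
      ← dirD_congr hU e1 hq]
    rfl
  have h2 : normalConn F Y (normalConn F X ξ) q
      = normalProj F q (dirD Y φ₁ q • ξ q + φ₁ q • dirD Y ξ q) := by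
    rw [← dirD_smul (differentiableAt_of_smoothOn hU h.smooth_φ₁ hq) hξ,
      ← dirD_congr hU e2 hq]
    rfl
  have h3 : normalConn F (VectorField.lieBracket ℝ X Y) ξ q
      = normalProj F q ((-ω₂ q) • dirD X ξ q + (-ω₁ q) • dirD Y ξ q) := by
    unfold normalConn
    rw [h.lieBracket_eq hq, map_add, map_smul, map_smul]
    rfl
  unfold normalCurvTensor
  rw [h1, h2, h3, h.dXξ q hq, h.dYξ q hq]
  simp only [h.normalProj_eq hq, ip_add_left, ip_sub_left, ip_smul_left, B.n₁₁, B.n₁₂, B.n₂₂,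
    B.en₁₁, B.en₁₂, B.en₂₁, B.en₂₂]
  linarith [h.ricci hq]

end AdaptedFrame

/-! ### Gaussian curvature, and frame independence of the squared normal curvature. -/

namespace AdaptedFrame

variable {F : Plane → E52} {U : Set Plane} {X Y : Plane → Plane}
    {ξ η : Plane → E52} {ω₁ ω₂ φ₁ φ₂ a b c d : Plane → ℝ} {q : Plane}

/-- The covariant derivatives of the coordinate fields are smooth, and they are determined by
the second derivative of `F`. -/
lemma smoothOn_leviCivita (h : AdaptedFrame F U X Y ξ η ω₁ ω₂ φ₁ φ₂ a b c d) (i j : Fin 2) :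
    ∃ T : Plane → Plane, ContDiffOn ℝ ∞ T U ∧
      EqOn (leviCivita F (fun _ => basisVec i) (fun _ => basisVec j)) T U ∧
      ∀ q ∈ U, ∀ v, ip (fderiv ℝ F q (T q)) (fderiv ℝ F q v)
        = ip (pd i (pd j F) q) (fderiv ℝ F q v) := by
  have hU := h.isOpen
  have key : ∀ q ∈ U, ∀ v, ip (fderiv ℝ F q
      (leviCivita F (fun _ => basisVec i) (fun _ => basisVec j) q)) (fderiv ℝ F q v)
        = ip (pd i (pd j F) q) (fderiv ℝ F q v) := by
    intro q hq v
    exact ip_fderiv_leviCivita hU h.smooth_F hq (h.isUnit_gram_det hq) (fun _ => basisVec i)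
      (Z := fun _ => basisVec j) (by fun_prop) v
  have sE := smoothOn_dirD hU h.smooth_X h.smooth_F
  have sE' := smoothOn_dirD hU h.smooth_Y h.smooth_F
  have sj : ContDiffOn ℝ ∞ (pd j F) U :=
    smoothOn_dirD (X := fun _ => basisVec j) hU contDiffOn_const h.smooth_F
  have sij : ContDiffOn ℝ ∞ (pd i (pd j F)) U :=
    smoothOn_dirD (X := fun _ => basisVec i) hU contDiffOn_const sj
  have heq : EqOn (leviCivita F (fun _ => basisVec i) (fun _ => basisVec j))
      (fun q => (-ip (pd i (pd j F) q) (dirD Y F q)) • X q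
        + (-ip (pd i (pd j F) q) (dirD X F q)) • Y q) U := by
    intro q hq
    have h1 := h.field_expand hq (leviCivita F (fun _ => basisVec i) (fun _ => basisVec j) q)
    unfold inducedMetric at h1
    rw [key q hq, key q hq] at h1
    exact h1
  refine ⟨_, ?_, heq, fun q hq v => ?_⟩
  · exact ((smoothOn_ip sij sE').neg.smul h.smooth_X).add
      ((smoothOn_ip sij sE).neg.smul h.smooth_Y)
  · have := key q hq v
    rw [heq hq] at this
    exact this

/-- The Gauss equation for the definition of the Gaussian curvature. -/
lemma gauss_numerator (h : AdaptedFrame F U X Y ξ η ω₁ ω₂ φ₁ φ₂ a b c d) (hq : q ∈ U) :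
    ∃ n₀₁ n₁₁ : E52, (∃ t, n₀₁ = hess F q (basisVec 0) (basisVec 1) - fderiv ℝ F q t) ∧
      (∃ t, n₁₁ = hess F q (basisVec 1) (basisVec 1) - fderiv ℝ F q t) ∧
      (∀ r, ip n₀₁ (fderiv ℝ F q r) = 0) ∧ (∀ r, ip n₁₁ (fderiv ℝ F q r) = 0) ∧
      inducedMetric F q
        (curvature F (fun _ => basisVec 0) (fun _ => basisVec 1) (fun _ => basisVec 1) q)
        (basisVec 0) = ip n₁₁ (hess F q (basisVec 0) (basisVec 0))
          - ip n₀₁ (hess F q (basisVec 0) (basisVec 1)) := by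
  have hU := h.isOpen
  obtain ⟨T₁, sT₁, eT₁, pT₁⟩ := h.smoothOn_leviCivita 1 1
  obtain ⟨T₀, sT₀, eT₀, pT₀⟩ := h.smoothOn_leviCivita 0 1
  have D {W : Type} [NormedAddCommGroup W] [NormedSpace ℝ W] {f : Plane → W}
    (hf : ContDiffOn ℝ ∞ f U) := differentiableAt_of_smoothOn hU hf hq
  have hF := h.smooth_F
  have s0 : ContDiffOn ℝ ∞ (pd 0 F) U :=
    smoothOn_dirD (X := fun _ => basisVec 0) hU contDiffOn_const hF
  have s1 : ContDiffOn ℝ ∞ (pd 1 F) U :=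
    smoothOn_dirD (X := fun _ => basisVec 1) hU contDiffOn_const hF
  have s11 : ContDiffOn ℝ ∞ (pd 1 (pd 1 F)) U :=
    smoothOn_dirD (X := fun _ => basisVec 1) hU contDiffOn_const s1
  have s01 : ContDiffOn ℝ ∞ (pd 0 (pd 1 F)) U :=
    smoothOn_dirD (X := fun _ => basisVec 0) hU contDiffOn_const s1
  have sT : ∀ {T : Plane → Plane}, ContDiffOn ℝ ∞ T U →
      ContDiffOn ℝ ∞ (fun r => fderiv ℝ F r (T r)) U := fun hT => smoothOn_dirD hU hT hF
  -- derivative of a product with a coordinate field, for a field with the tangential part `T`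
  have main : ∀ (i : Fin 2) (T : Plane → Plane) (N : Plane → E52), ContDiffOn ℝ ∞ T U →
      ContDiffOn ℝ ∞ N U →
      (∀ q ∈ U, ∀ v, ip (fderiv ℝ F q (T q)) (fderiv ℝ F q v) = ip (N q) (fderiv ℝ F q v)) →
      ip (fderiv ℝ (fun r => fderiv ℝ F r (T r)) q (basisVec i)) (fderiv ℝ F q (basisVec 0))
        = ip (pd i N q) (fderiv ℝ F q (basisVec 0))
          + ip (N q - fderiv ℝ F q (T q)) (pd i (pd 0 F) q) := by
    intro i T N hT hN hTN
    have e : EqOn (fun r => ip (fderiv ℝ F r (T r)) (pd 0 F r)) (fun r => ip (N r) (pd 0 F r)) U :=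
      fun r hr => hTN r hr _
    have h1 := dirD_congr (X := fun _ => basisVec i) hU e hq
    rw [dirD_ip (D (sT hT)) (D s0), dirD_ip (D hN) (D s0)] at h1
    rw [ip_sub_left]
    simp only [dirD] at h1
    have h2 : fderiv ℝ (pd 0 F) q (basisVec i) = pd i (pd 0 F) q := rfl
    have h3 : fderiv ℝ N q (basisVec i) = pd i N q := rfl
    have h4 : pd 0 F q = fderiv ℝ F q (basisVec 0) := rfl
    rw [h2, h3, h4] at h1
    linarith
  -- The third derivatives cancel by symmetry, so only products of normal parts with second
  -- derivatives survive.
  have hcomm : pd 0 (pd 1 (pd 1 F)) q = pd 1 (pd 0 (pd 1 F)) q := by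
    rw [pd_pd hU s1 hq, pd_pd hU s1 hq, hess_comm hU s1 hq]
  refine ⟨hess F q (basisVec 0) (basisVec 1) - fderiv ℝ F q (T₀ q),
    hess F q (basisVec 1) (basisVec 1) - fderiv ℝ F q (T₁ q), ⟨_, rfl⟩, ⟨_, rfl⟩, fun r => ?_,
    fun r => ?_, ?_⟩
  · rw [ip_sub_left, pT₀ q hq, pd_pd hU hF hq, sub_self]
  · rw [ip_sub_left, pT₁ q hq, pd_pd hU hF hq, sub_self]
  · have hlie : VectorField.lieBracket ℝ (fun _ : Plane => basisVec 0)
        (fun _ : Plane => basisVec 1) q = 0 := by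
      simp [VectorField.lieBracket]
    have hL : leviCivita F (VectorField.lieBracket ℝ (fun _ : Plane => basisVec 0)
        (fun _ : Plane => basisVec 1)) (fun _ => basisVec 1) q = 0 := by
      ext k
      simp [leviCivita, hlie]
    unfold inducedMetric curvature
    rw [hL, sub_zero, leviCivita_congr hU eT₁ hq, leviCivita_congr hU eT₀ hq, map_sub, ip_sub_left,
      ip_fderiv_leviCivita hU hF hq (h.isUnit_gram_det hq) _ (D sT₁),
      ip_fderiv_leviCivita hU hF hq (h.isUnit_gram_det hq) _ (D sT₀),
      main 0 T₁ _ sT₁ s11 pT₁, main 1 T₀ _ sT₀ s01 pT₀, hcomm, pd_pd hU hF hq, pd_pd hU hF hq,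
      pd_pd hU hF hq, pd_pd hU hF hq, hess_comm hU hF hq (basisVec 1) (basisVec 0)]
    ring

/-- Written in `X, Y`, numerator and denominator both carry the factor minus the squared determinant
of the change of basis. The summand `1` comes from the position component of the mixed second
derivative. -/
lemma gaussK_eq (h : AdaptedFrame F U X Y ξ η ω₁ ω₂ φ₁ φ₂ a b c d) (hq : q ∈ U) :
    gaussK F q = 1 + a q * d q + b q * c q := by
  have B := h.basis q hq
  obtain ⟨n₀₁, n₁₁, ⟨t₀, ht₀⟩, ⟨t₁, ht₁⟩, p₀, p₁, hnum⟩ := h.gauss_numerator hq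
  obtain ⟨u₀, v₀, e₀⟩ : ∃ u v : ℝ, basisVec 0 = u • X q + v • Y q := ⟨_, _, h.field_expand hq _⟩
  obtain ⟨u₁, v₁, e₁⟩ : ∃ u v : ℝ, basisVec 1 = u • X q + v • Y q := ⟨_, _, h.field_expand hq _⟩
  obtain ⟨w₀₀, h₀₀⟩ := h.hess_normal hq u₀ v₀ u₀ v₀
  obtain ⟨w₀₁, h₀₁⟩ := h.hess_normal hq u₀ v₀ u₁ v₁
  obtain ⟨w₁₁, h₁₁⟩ := h.hess_normal hq u₁ v₁ u₁ v₁
  rw [← e₀] at h₀₀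
  rw [← e₀, ← e₁] at h₀₁
  rw [← e₁] at h₁₁
  have hN : ∀ x y z w u : ℝ, ∀ r,
      ip (x • (y • ξ q + z • η q) + w • F q + u • (c q • ξ q + d q • η q))
      (fderiv ℝ F q r) = 0 := by
    intro x y z w u r
    obtain ⟨z1, z2, z3⟩ := h.ip_fderiv_normal hq r
    rw [ip_comm] at z1 z2 z3
    simp only [ip_add_left, ip_smul_left, z1, z2, z3]
    ring
  have r₀₁ := h.eq_of_tangent_normal hq h₀₁ (hN _ _ _ _ _) (w := n₀₁) (t := t₀) rfl
    (fun r => by have := p₀ r; rw [ht₀, ip_sub_left] at this; linarith) ht₀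
  have r₁₁ := h.eq_of_tangent_normal hq h₁₁ (hN _ _ _ _ _) (w := n₁₁) (t := t₁) rfl
    (fun r => by have := p₁ r; rw [ht₁, ip_sub_left] at this; linarith) ht₁
  have g : ∀ u v u' v' : ℝ, inducedMetric F q (u • X q + v • Y q) (u' • X q + v' • Y q)
      = -(u * v' + v * u') := by
    intro u v u' v'
    unfold inducedMetric
    have e1 : fderiv ℝ F q (X q) = dirD X F q := rfl
    have e2 : fderiv ℝ F q (Y q) = dirD Y F q := rfl
    simp only [map_add, map_smul, e1, e2, ip_add_left, ip_add_right, ip_smul_left, ip_smul_right,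
      B.e₁₁, B.e₁₂, B.e₂₁, B.e₂₂]
    ring
  have hnum' : inducedMetric F q
        (curvature F (fun _ => basisVec 0) (fun _ => basisVec 1) (fun _ => basisVec 1) q)
        (basisVec 0) = -((u₀ * v₁ - v₀ * u₁) ^ 2) * (1 + a q * d q + b q * c q) := by
    rw [hnum, h₀₀, h₀₁, ip_add_right n₁₁ (fderiv ℝ F q _), ip_add_right n₀₁ (fderiv ℝ F q _),
      p₀, p₁, r₀₁, r₁₁]
    simp only [ip_add_left, ip_smul_left, ip_add_right, ip_smul_right, B.n₁₁, B.n₁₂, B.n₂₁, B.n₂₂,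
      B.pp, B.pn₁, B.pn₂, B.np₁, B.np₂]
    ring
  have hne : u₀ * v₁ - v₀ * u₁ ≠ 0 := by
    have z0 := congrArg (fun v : Plane => v 0) e₀
    have z1 := congrArg (fun v : Plane => v 1) e₀
    have z2 := congrArg (fun v : Plane => v 0) e₁
    have z3 := congrArg (fun v : Plane => v 1) e₁
    simp [basisVec] at z0 z1 z2 z3
    intro h0
    have : (u₀ * v₁ - v₀ * u₁) * (X q 0 * Y q 1 - X q 1 * Y q 0) = 1 := by
      calc _ = (u₀ * X q 0 + v₀ * Y q 0) * (u₁ * X q 1 + v₁ * Y q 1)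
            - (u₀ * X q 1 + v₀ * Y q 1) * (u₁ * X q 0 + v₁ * Y q 0) := by ring
        _ = 1 := by rw [← z0, ← z1, ← z2, ← z3]; ring
    rw [h0, zero_mul] at this
    exact zero_ne_one this
  unfold gaussK
  rw [hnum', e₀, e₁, g, g, g]
  have hden : -(u₀ * v₀ + v₀ * u₀) * -(u₁ * v₁ + v₁ * u₁) - (-(u₀ * v₁ + v₀ * u₁)) ^ 2
      = -((u₀ * v₁ - v₀ * u₁) ^ 2) := by ring
  rw [hden, mul_div_cancel_left₀]
  exact neg_ne_zero.2 (pow_ne_zero 2 hne)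

/-- The square of the normal curvature does not depend on the adapted frame. -/
lemma normalCurv_sq_eq (h : AdaptedFrame F U X Y ξ η ω₁ ω₂ φ₁ φ₂ a b c d) (hq : q ∈ U)
    {U' : Set Plane} {X' Y' : Plane → Plane} {ξ' η' : Plane → E52}
    {ω₁' ω₂' φ₁' φ₂' a' b' c' d' : Plane → ℝ}
    (h' : AdaptedFrame F U' X' Y' ξ' η' ω₁' ω₂' φ₁' φ₂' a' b' c' d') (hq' : q ∈ U') :
    (a' q * d' q - b' q * c' q) ^ 2 = (a q * d q - b q * c q) ^ 2 := by
  have B := h.basis q hq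
  have B' := h'.basis q hq'
  have H : ∀ u v u' v' : ℝ, normalProj F q (hess F q (u • X q + v • Y q) (u' • X q + v' • Y q))
      = (u * u') • (a q • ξ q + b q • η q) + (v * v') • (c q • ξ q + d q • η q) := by
    intro u v u' v'
    obtain ⟨w, hw⟩ := h.hess_normal hq u v u' v'
    obtain ⟨z1, z2, z3⟩ := h.ip_fderiv_normal hq w
    rw [hw, h.normalProj_eq hq]
    simp only [ip_add_left, ip_smul_left, z1, z2, B.n₁₁, B.n₁₂, B.n₂₁, B.n₂₂, B.pn₁, B.pn₂]
    module
  have H' : ∀ u v u' v' : ℝ,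
      normalProj F q (hess F q (u • X' q + v • Y' q) (u' • X' q + v' • Y' q))
      = (u * u') • (a' q • ξ' q + b' q • η' q) + (v * v') • (c' q • ξ' q + d' q • η' q) := by
    intro u v u' v'
    obtain ⟨w, hw⟩ := h'.hess_normal hq' u v u' v'
    obtain ⟨z1, z2, z3⟩ := h'.ip_fderiv_normal hq' w
    rw [hw, h'.normalProj_eq hq']
    simp only [ip_add_left, ip_smul_left, z1, z2, B'.n₁₁, B'.n₁₂, B'.n₂₁, B'.n₂₂, B'.pn₁, B'.pn₂]
    module
  obtain ⟨u, v, e⟩ : ∃ u v : ℝ, X' q = u • X q + v • Y q := ⟨_, _, h.field_expand hq _⟩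
  obtain ⟨u', v', e'⟩ : ∃ u v : ℝ, Y' q = u • X q + v • Y q := ⟨_, _, h.field_expand hq _⟩
  have g : ∀ u v u' v' : ℝ, ip (fderiv ℝ F q (u • X q + v • Y q))
      (fderiv ℝ F q (u' • X q + v' • Y q)) = -(u * v' + v * u') := by
    intro u v u' v'
    have e1 : fderiv ℝ F q (X q) = dirD X F q := rfl
    have e2 : fderiv ℝ F q (Y q) = dirD Y F q := rfl
    simp only [map_add, map_smul, e1, e2, ip_add_left, ip_add_right, ip_smul_left, ip_smul_right,
      B.e₁₁, B.e₁₂, B.e₂₁, B.e₂₂]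
    ring
  have g₁₁ : ip (fderiv ℝ F q (X' q)) (fderiv ℝ F q (X' q)) = 0 := B'.e₁₁
  have g₁₂ : ip (fderiv ℝ F q (X' q)) (fderiv ℝ F q (Y' q)) = -1 := B'.e₁₂
  have g₂₂ : ip (fderiv ℝ F q (Y' q)) (fderiv ℝ F q (Y' q)) = 0 := B'.e₂₂
  rw [e, g] at g₁₁
  rw [e, e', g] at g₁₂
  rw [e', g] at g₂₂
  have hX := H' 1 0 1 0
  have hY := H' 0 1 0 1
  simp only [one_smul, zero_smul, add_zero, zero_add, mul_one, mul_zero] at hX hY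
  rw [e, H] at hX
  rw [e', H] at hY
  have p₁₁ := congrArg₂ ip hX hX
  have p₂₂ := congrArg₂ ip hY hY
  simp only [ip_add_left, ip_smul_left, ip_add_right, ip_smul_right, B.n₁₁, B.n₁₂, B.n₂₁, B.n₂₂,
    B'.n₁₁, B'.n₁₂, B'.n₂₁, B'.n₂₂] at p₁₁ p₂₂
  -- A null direction is a multiple of `X` or of `Y`.
  have huv : u * v = 0 := by linarith
  have huv' : u' * v' = 0 := by linarith
  have h1 : u * v' + v * u' = 1 := by linarith
  have f₁ : (a' q * d' q + b' q * c' q) = (a q * d q + b q * c q) := by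
    linarith [h.gaussK_eq hq, h'.gaussK_eq hq']
  have f₂ : a' q * b' q = u ^ 4 * (a q * b q) + v ^ 4 * (c q * d q) := by
    have : u * u * (v * v) = 0 := by
      rw [show u * u * (v * v) = (u * v) * (u * v) by ring, huv, zero_mul]
    linear_combination (1 / 2) * p₁₁ + (a q * d q + b q * c q) * this
  have f₃ : c' q * d' q = u' ^ 4 * (a q * b q) + v' ^ 4 * (c q * d q) := by
    have : u' * u' * (v' * v') = 0 := by
      rw [show u' * u' * (v' * v') = (u' * v') * (u' * v') by ring, huv', zero_mul]
    linear_combination (1 / 2) * p₂₂ + (a q * d q + b q * c q) * this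
  -- Since `⟨X', Y'⟩ = -1`, the two new directions are multiples of different old ones, with inverse
  -- factors. The fourth powers cancel in the product of the squared lengths of `h(X, X)` and `h(Y,
  -- Y)`.
  have f₄ : (a' q * b' q) * (c' q * d' q) = (a q * b q) * (c q * d q) := by
    rcases mul_eq_zero.1 huv with h0 | h0 <;> rcases mul_eq_zero.1 huv' with h0' | h0'
    · rw [h0, h0'] at h1; norm_num at h1
    · have h2 : v * u' = 1 := by rw [h0, h0'] at h1; linarith
      have h3 : v ^ 4 * u' ^ 4 = 1 := by rw [← mul_pow, h2, one_pow]
      rw [f₂, f₃, h0, h0']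
      linear_combination (a q * b q) * (c q * d q) * h3
    · have h2 : u * v' = 1 := by rw [h0, h0'] at h1; linarith
      have h3 : u ^ 4 * v' ^ 4 = 1 := by rw [← mul_pow, h2, one_pow]
      rw [f₂, f₃, h0, h0']
      linear_combination (a q * b q) * (c q * d q) * h3
    · rw [h0, h0'] at h1; norm_num at h1
  -- Uses `(ad - bc)² = (ad + bc)² - 4 (ab)(cd)`: the sum is `K - 1`, and the last product is
  -- invariant by `f₄`.
  linear_combination (a' q * d' q + b' q * c' q + (a q * d q + b q * c q)) * f₁ - 4 * f₄

end AdaptedFrame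

/-! ### Existence of adapted frames -/

section

variable {F : Plane → E52} {U : Set Plane} {X Y : Plane → Plane} {ξ η : Plane → E52} {q : Plane}

/-- For a minimal surface, the second derivative in two null directions is tangent to the surface
up to the position vector. -/
lemma ip_hess_of_meanCurvature_eq_zero (hU : IsOpen U) (hF : ContDiffOn ℝ ∞ F U) (hq : q ∈ U)
    (hmin : meanCurvature F q = 0) {v w : Plane} (h₁₁ : inducedMetric F q v v = 0)
    (h₁₂ : inducedMetric F q v w = -1) (h₂₂ : inducedMetric F q w w = 0) {n : E52}
    (hn : ip n (F q) = 0 ∧ ∀ a, ip n (fderiv ℝ F q a) = 0) : ip (hess F q v w) n = 0 := by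
  have hi := Matrix.inv_eq_right_inv (gram_inv h₁₁ h₁₂ h₂₂)
  have hS : ∀ i j, ip (secondFFSphere F i j q) n = ip (hess F q (basisVec i) (basisVec j)) n := by
    intro i j
    unfold secondFFSphere secondFF
    rw [ip_sub_left, ip_sub_left, ip_smul_left, ip_comm (F q), hn.1, ip_comm (fderiv ℝ F q _),
      hn.2, pd_pd hU hF hq]
    ring
  -- The inverse Gram matrix is minus the symmetrized product of `v` and `w`, so half the trace of
  -- the Hessian is minus its value on `(v, w)`.
  have h1 := congrArg (fun v => ip v n) hmin
  simp only [meanCurvature, hi, ip_smul_left, ip_add_left, Fin.sum_univ_two, hS, Matrix.of_apply,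
    ip_zero_left] at h1
  rw [hess_comm hU hF hq (basisVec 1) (basisVec 0)] at h1
  conv_lhs => rw [eq_sum_basisVec v, eq_sum_basisVec w]
  simp only [hess_add_left, hess_add_right, hess_smul_left, hess_smul_right, ip_add_left,
    ip_smul_left]
  rw [hess_comm hU hF hq (basisVec 1) (basisVec 0)]
  linarith

/-- The Leibniz rule, which makes the matrix of connection coefficients of a null frame skew. -/
lemma ip_dirD_of_const (hU : IsOpen U) {f g : Plane → E52} (hf : ContDiffOn ℝ ∞ f U)
    (hg : ContDiffOn ℝ ∞ g U) {k : ℝ} (hk : ∀ r ∈ U, ip (f r) (g r) = k) (hq : q ∈ U)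
    (Z : Plane → Plane) : ip (dirD Z f q) (g q) = -ip (dirD Z g q) (f q) := by
  have h1 := dirD_congr (X := Z) hU (f := fun r => ip (f r) (g r)) (g := fun _ => k) hk hq
  rw [dirD_ip (differentiableAt_of_smoothOn hU hf hq) (differentiableAt_of_smoothOn hU hg hq),
    dirD_const, ip_comm (f q)] at h1
  linarith

/-- Expand each derivative of a frame vector in the null basis. Skewness leaves two connection forms
and the second fundamental form, and minimality removes the normal components of the mixed
derivatives. -/
theorem exists_adaptedFrame (hU : IsOpen U) (hF : ContDiffOn ℝ ∞ F U)
    (hS : ∀ q ∈ U, ip (F q) (F q) = 1) (hmin : ∀ q ∈ U, meanCurvature F q = 0)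
    (h : IsPseudoOrthonormalFrame F U X Y ξ η) :
    ∃ ω₁ ω₂ φ₁ φ₂ a b c d : Plane → ℝ, AdaptedFrame F U X Y ξ η ω₁ ω₂ φ₁ φ₂ a b c d := by
  have sX := smoothOn_dirD hU h.smooth₁ hF
  have sY := smoothOn_dirD hU h.smooth₂ hF
  have sξ := h.smooth₃
  have sη := h.smooth₄
  have sXX := smoothOn_dirD hU h.smooth₁ sX
  have sYX := smoothOn_dirD hU h.smooth₂ sX
  have sYY := smoothOn_dirD hU h.smooth₂ sY
  have hFt : ∀ q ∈ U, ∀ Z : Plane → Plane, ip (F q) (dirD Z F q) = 0 := by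
    intro q hq Z
    have := ip_dirD_of_const hU hF hF hS hq Z
    rw [ip_comm]
    linarith
  have B : ∀ q ∈ U, IsNullBasis (dirD X F q) (dirD Y F q) (ξ q) (η q) (F q) := fun q hq =>
    ⟨h.tangent₁₁ q hq, h.tangent₁₂ q hq, h.tangent₂₂ q hq, h.normal₃₃ q hq, h.normal₃₄ q hq,
      h.normal₄₄ q hq, hS q hq, (h.normal₃ q hq).2 _, (h.normal₃ q hq).2 _, (h.normal₄ q hq).2 _,
      (h.normal₄ q hq).2 _, hFt q hq X, hFt q hq Y, by rw [ip_comm]; exact (h.normal₃ q hq).1,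
      by rw [ip_comm]; exact (h.normal₄ q hq).1⟩
  have hXY : ∀ q ∈ U, ∀ n : E52, (ip n (F q) = 0 ∧ ∀ a, ip n (fderiv ℝ F q a) = 0) →
      ip (dirD X (dirD Y F) q) n = 0 ∧ ip (dirD Y (dirD X F) q) n = 0 := by
    intro q hq n hn
    have h0 := ip_hess_of_meanCurvature_eq_zero hU hF hq (hmin q hq) (h.tangent₁₁ q hq)
      (h.tangent₁₂ q hq) (h.tangent₂₂ q hq) hn
    have h1 := fderiv_fderiv_apply hU hF (differentiableAt_of_smoothOn hU h.smooth₂ hq) hq (X q)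
    have h2 := fderiv_fderiv_apply hU hF (differentiableAt_of_smoothOn hU h.smooth₁ hq) hq (Y q)
    have h1' : dirD X (dirD Y F) q = _ := h1
    have h2' : dirD Y (dirD X F) q = _ := h2
    rw [h1', h2', ip_add_left, ip_add_left, ip_comm (fderiv ℝ F q _), hn.2,
      ip_comm (fderiv ℝ F q _), hn.2, hess_comm hU hF hq (Y q), h0]
    simp
  refine ⟨fun r => -ip (dirD X (dirD X F) r) (dirD Y F r),
    fun r => -ip (dirD Y (dirD X F) r) (dirD Y F r), fun r => -ip (dirD X ξ r) (η r),
    fun r => -ip (dirD Y ξ r) (η r), fun r => -ip (dirD X (dirD X F) r) (η r),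
    fun r => -ip (dirD X (dirD X F) r) (ξ r), fun r => -ip (dirD Y (dirD Y F) r) (η r),
    fun r => -ip (dirD Y (dirD Y F) r) (ξ r), ?_⟩
  -- the products of the derivatives of the frame with the frame
  have rXX : ∀ q ∈ U, ∀ Z, ip (dirD Z (dirD X F) q) (dirD X F q) = 0 := fun q hq Z => by
    linarith [ip_dirD_of_const hU sX sX (fun r hr => (B r hr).e₁₁) hq Z]
  have rYY : ∀ q ∈ U, ∀ Z, ip (dirD Z (dirD Y F) q) (dirD Y F q) = 0 := fun q hq Z => by
    linarith [ip_dirD_of_const hU sY sY (fun r hr => (B r hr).e₂₂) hq Z]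
  have rYX : ∀ q ∈ U, ∀ Z, ip (dirD Z (dirD Y F) q) (dirD X F q)
      = -ip (dirD Z (dirD X F) q) (dirD Y F q) := fun q hq Z =>
    ip_dirD_of_const hU sY sX (fun r hr => (B r hr).e₂₁) hq Z
  have rXF : ∀ q ∈ U, ∀ Z, ip (dirD Z (dirD X F) q) (F q) = -ip (dirD Z F q) (dirD X F q) :=
    fun q hq Z => ip_dirD_of_const hU sX hF (fun r hr => (B r hr).ep₁) hq Z
  have rYF : ∀ q ∈ U, ∀ Z, ip (dirD Z (dirD Y F) q) (F q) = -ip (dirD Z F q) (dirD Y F q) :=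
    fun q hq Z => ip_dirD_of_const hU sY hF (fun r hr => (B r hr).ep₂) hq Z
  have rξξ : ∀ q ∈ U, ∀ Z, ip (dirD Z ξ q) (ξ q) = 0 := fun q hq Z => by
    linarith [ip_dirD_of_const hU sξ sξ (fun r hr => (B r hr).n₁₁) hq Z]
  have rηη : ∀ q ∈ U, ∀ Z, ip (dirD Z η q) (η q) = 0 := fun q hq Z => by
    linarith [ip_dirD_of_const hU sη sη (fun r hr => (B r hr).n₂₂) hq Z]
  have rηξ : ∀ q ∈ U, ∀ Z, ip (dirD Z η q) (ξ q) = -ip (dirD Z ξ q) (η q) := fun q hq Z =>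
    ip_dirD_of_const hU sη sξ (fun r hr => (B r hr).n₂₁) hq Z
  have rξX : ∀ q ∈ U, ∀ Z, ip (dirD Z ξ q) (dirD X F q) = -ip (dirD Z (dirD X F) q) (ξ q) :=
    fun q hq Z => ip_dirD_of_const hU sξ sX (fun r hr => (B r hr).ne₁₁) hq Z
  have rξY : ∀ q ∈ U, ∀ Z, ip (dirD Z ξ q) (dirD Y F q) = -ip (dirD Z (dirD Y F) q) (ξ q) :=
    fun q hq Z => ip_dirD_of_const hU sξ sY (fun r hr => (B r hr).ne₁₂) hq Z
  have rηX : ∀ q ∈ U, ∀ Z, ip (dirD Z η q) (dirD X F q) = -ip (dirD Z (dirD X F) q) (η q) :=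
    fun q hq Z => ip_dirD_of_const hU sη sX (fun r hr => (B r hr).ne₂₁) hq Z
  have rηY : ∀ q ∈ U, ∀ Z, ip (dirD Z η q) (dirD Y F q) = -ip (dirD Z (dirD Y F) q) (η q) :=
    fun q hq Z => ip_dirD_of_const hU sη sY (fun r hr => (B r hr).ne₂₂) hq Z
  have rξF : ∀ q ∈ U, ∀ Z, ip (dirD Z ξ q) (F q) = -ip (dirD Z F q) (ξ q) :=
    fun q hq Z => ip_dirD_of_const hU sξ hF (fun r hr => (B r hr).np₁) hq Z
  have rηF : ∀ q ∈ U, ∀ Z, ip (dirD Z η q) (F q) = -ip (dirD Z F q) (η q) :=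
    fun q hq Z => ip_dirD_of_const hU sη hF (fun r hr => (B r hr).np₂) hq Z
  have mξ : ∀ q ∈ U, ip (dirD X (dirD Y F) q) (ξ q) = 0 ∧ ip (dirD Y (dirD X F) q) (ξ q) = 0 :=
    fun q hq => hXY q hq _ (h.normal₃ q hq)
  have mη : ∀ q ∈ U, ip (dirD X (dirD Y F) q) (η q) = 0 ∧ ip (dirD Y (dirD X F) q) (η q) = 0 :=
    fun q hq => hXY q hq _ (h.normal₄ q hq)
  refine ⟨hU, hF, h.smooth₁, h.smooth₂, sξ, sη, (smoothOn_ip sXX sY).neg, (smoothOn_ip sYX sY).neg,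
    (smoothOn_ip (smoothOn_dirD hU h.smooth₁ sξ) sη).neg,
    (smoothOn_ip (smoothOn_dirD hU h.smooth₂ sξ) sη).neg, (smoothOn_ip sXX sη).neg,
    (smoothOn_ip sXX sξ).neg, (smoothOn_ip sYY sη).neg, (smoothOn_ip sYY sξ).neg, B,
    fun q hq => ?_, fun q hq => ?_, fun q hq => ?_, fun q hq => ?_, fun q hq => ?_, fun q hq => ?_,
    fun q hq => ?_, fun q hq => ?_⟩
  all_goals have b := B q hq
  · refine (b.eq_comb (y := 0) (u := 0) (neg_neg _).symm ?_ (neg_neg _).symm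
      (neg_neg _).symm ?_).trans (by module)
    · rw [rXX q hq, neg_zero]
    · rw [rXF q hq, b.e₁₁, neg_zero]
  -- The position component is `-⟨dF(Y), dF(X)⟩ = 1`, the contribution of the sphere.
  · refine (b.eq_comb (y := 0) (z := 0) (w := 0) (u := 1) (neg_neg _).symm ?_ ?_ ?_ ?_).trans
      (by module)
    · rw [rXX q hq, neg_zero]
    · rw [(mη q hq).2, neg_zero]
    · rw [(mξ q hq).2, neg_zero]
    · rw [rXF q hq, b.e₂₁, neg_neg]
  · refine (b.eq_comb (x := 0) (y := ip (dirD X (dirD X F) q) (dirD Y F q)) (z := 0) (w := 0)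
      (u := 1) ?_ ?_ ?_ ?_ ?_).trans (by module)
    · rw [rYY q hq, neg_zero]
    · rw [rYX q hq]
    · rw [(mη q hq).1, neg_zero]
    · rw [(mξ q hq).1, neg_zero]
    · rw [rYF q hq, b.e₁₂, neg_neg]
  · refine (b.eq_comb (x := 0) (y := ip (dirD Y (dirD X F) q) (dirD Y F q)) (u := 0) ?_ ?_
      (neg_neg _).symm (neg_neg _).symm ?_).trans (by module)
    · rw [rYY q hq, neg_zero]
    · rw [rYX q hq]
    · rw [rYF q hq, b.e₂₂, neg_zero]
  · refine (b.eq_comb (x := 0) (y := ip (dirD X (dirD X F) q) (ξ q)) (w := 0) (u := 0) ?_ ?_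
      (neg_neg _).symm ?_ ?_).trans (by module)
    · rw [rξY q hq, (mξ q hq).1]
    · rw [rξX q hq]
    · rw [rξξ q hq, neg_zero]
    · rw [rξF q hq, b.en₁₁, neg_zero]
  · refine (b.eq_comb (x := ip (dirD Y (dirD Y F) q) (ξ q)) (y := 0) (w := 0) (u := 0) ?_ ?_
      (neg_neg _).symm ?_ ?_).trans (by module)
    · rw [rξY q hq]
    · rw [rξX q hq, (mξ q hq).2]
    · rw [rξξ q hq, neg_zero]
    · rw [rξF q hq, b.en₂₁, neg_zero]
  · refine (b.eq_comb (x := 0) (y := ip (dirD X (dirD X F) q) (η q)) (z := 0)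
      (w := ip (dirD X ξ q) (η q)) (u := 0) ?_ ?_ ?_ ?_ ?_).trans (by module)
    · rw [rηY q hq, (mη q hq).1]
    · rw [rηX q hq]
    · rw [rηη q hq, neg_zero]
    · rw [rηξ q hq]
    · rw [rηF q hq, b.en₁₂, neg_zero]
  · refine (b.eq_comb (x := ip (dirD Y (dirD Y F) q) (η q)) (y := 0) (z := 0)
      (w := ip (dirD Y ξ q) (η q)) (u := 0) ?_ ?_ ?_ ?_ ?_).trans (by module)
    · rw [rηY q hq]
    · rw [rηX q hq, (mη q hq).2]
    · rw [rηη q hq, neg_zero]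
    · rw [rηξ q hq]
    · rw [rηF q hq, b.en₂₂, neg_zero]

end

/-! ### Propagation of zeros along integral curves -/

/-- Integral curves exist for a uniform time, and stay in a given ball. -/
lemma exists_integralCurve_mem_closedBall {E : Type*} [NormedAddCommGroup E] [NormedSpace ℝ E]
    [CompleteSpace E] {V : E → E} {x₀ : E} (hV : ContDiffAt ℝ 1 V x₀) {ρ : ℝ} (hρ : 0 < ρ) :
    ∃ r > (0 : ℝ), ∃ τ > (0 : ℝ), ∀ x ∈ Metric.closedBall x₀ r, ∃ γ : ℝ → E, γ 0 = x ∧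
      ∀ t ∈ Icc (-τ) τ, γ t ∈ Metric.closedBall x₀ ρ ∧
        HasDerivWithinAt γ (V (γ t)) (Icc (-τ) τ) t := by
  obtain ⟨ε, hε, a, r, L, K, hr, hpl⟩ := IsPicardLindelof.of_contDiffAt_one hV
  have ha : 0 < a := by
    have h1 := (hpl 0).mul_max_le
    have h2 : (0 : ℝ) ≤ L * max (0 + ε - 0) (0 - (0 - ε)) :=
      mul_nonneg L.2 (le_max_of_le_left (by linarith))
    have h3 : (0 : ℝ) < r := hr
    have : (0 : ℝ) < a := by linarith
    exact this
  obtain ⟨ρ', hρ', rfl⟩ : ∃ ρ' : NNReal, 0 < ρ' ∧ (ρ' : ℝ) = ρ := ⟨⟨ρ, hρ.le⟩, hρ, rfl⟩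
  have hm : 0 < min a ρ' := lt_min ha hρ'
  -- Confining the curves to radius `min a ρ'` keeps them in the prescribed ball; starting points
  -- are taken in the ball of half that radius, with a common time `τ`.
  obtain ⟨τ, hτ, hpl'⟩ := IsPicardLindelof.exists_shrink_radius hε (hpl 0)
    (min_le_left a ρ') (half_lt_self hm)
  refine ⟨((min a ρ' / 2 : NNReal) : ℝ), by positivity, τ, hτ, fun x hx => ?_⟩
  obtain ⟨α, hα⟩ := ODE.FunSpace.exists_isFixedPt_next hpl' hx
  have hI : Icc (0 - τ) (0 + τ) = Icc (-τ) τ := by simp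
  refine ⟨α.compProj, ?_, fun t ht => ⟨?_, ?_⟩⟩
  · have := ODE.FunSpace.compProj_val (α := α) (t := ⟨0, by simp [hτ.le]⟩)
    rw [this, ← hα, ODE.FunSpace.next_apply₀]
  · exact Metric.closedBall_subset_closedBall (by simp)
      (α.compProj_mem_closedBall hpl'.mul_max_le (t := t))
  · rw [← hI] at ht ⊢
    apply ODE.hasDerivWithinAt_picard_Icc (t₀ := 0) (by simp [hτ.le]) hpl'.continuousOn_uncurry
      α.continuous_compProj.continuousOn (fun _ ht' ↦ α.compProj_mem_closedBall hpl'.mul_max_le)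
      x ht |>.congr_of_mem _ ht
    intro t' ht'
    nth_rw 1 [← hα]
    rw [ODE.FunSpace.compProj_of_mem ht', ODE.FunSpace.next_apply]

/-- A solution of a linear differential equation which vanishes somewhere is zero. -/
lemma eq_zero_of_linear_ode {y m : ℝ → ℝ} {τ K : ℝ}
    (hy : ∀ t ∈ Icc (-τ) τ, HasDerivWithinAt y (m t * y t) (Icc (-τ) τ) t)
    (hm : ∀ t ∈ Icc (-τ) τ, |m t| ≤ K) {t₀ t₁ : ℝ} (h₀ : t₀ ∈ Icc (-τ) τ) (h₁ : t₁ ∈ Icc (-τ) τ)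
    (h : y t₁ = 0) : y t₀ = 0 := by
  have forward : ∀ {y m : ℝ → ℝ} {t₀ t₁ : ℝ},
      (∀ t ∈ Icc (-τ) τ, HasDerivWithinAt y (m t * y t) (Icc (-τ) τ) t) →
      (∀ t ∈ Icc (-τ) τ, |m t| ≤ K) → t₀ ∈ Icc (-τ) τ → t₁ ∈ Icc (-τ) τ → t₁ ≤ t₀ → y t₁ = 0 →
      y t₀ = 0 := by
    intro y m t₀ t₁ hy hm h₀ h₁ hle h
    have hsub : Icc t₁ t₀ ⊆ Icc (-τ) τ := Icc_subset_Icc h₁.1 h₀.2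
    refine eq_zero_of_abs_deriv_le_mul_abs_self_of_eq_zero_right (f := y)
      (f' := fun t => m t * y t) (K := K) (a := t₁) (b := t₀)
      (fun t ht => ((hy t (hsub ht)).mono hsub).continuousWithinAt) (fun t ht => ?_) h
      (fun t ht => ?_) t₀ ⟨hle, le_refl _⟩
    · have ht' := hsub (Ico_subset_Icc_self ht)
      exact (hy t ht').mono_of_mem_nhdsWithin
        (Icc_mem_nhdsGE_of_mem ⟨ht'.1, ht.2.trans_le h₀.2⟩)
    · rw [norm_mul, Real.norm_eq_abs]
      exact mul_le_mul_of_nonneg_right (hm t (hsub (Ico_subset_Icc_self ht))) (norm_nonneg _)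
  rcases le_total t₁ t₀ with hle | hle
  · exact forward hy hm h₀ h₁ hle h
  -- Backward in time: reverse `t` and apply the forward Grönwall estimate.
  · have hmem : ∀ {t : ℝ}, t ∈ Icc (-τ) τ → -t ∈ Icc (-τ) τ := fun ht =>
      ⟨by linarith [ht.2], by linarith [ht.1]⟩
    have := forward (y := fun t => y (-t)) (m := fun t => -m (-t)) (t₀ := -t₀) (t₁ := -t₁)
      (fun t ht => ?_) (fun t ht => by rw [abs_neg]; exact hm _ (hmem ht)) (hmem h₀) (hmem h₁)
      (by linarith) (by simpa using h)
    · simpa using this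
    · have h1 := (hy (-t) (hmem ht)).scomp t (hasDerivWithinAt_neg t (Icc (-τ) τ))
        (fun s hs => hmem hs)
      refine h1.congr_deriv ?_
      simp

/-- Near a point where two vector fields are independent, the integral curve of the first field
through a point meets the integral curve of the second field through any other point. -/
lemma exists_integralCurves_meet {V W : Plane → Plane} {x₀ : Plane} (hV : ContDiffAt ℝ 1 V x₀)
    (hW : ContDiffAt ℝ 1 W x₀) (hli : LinearIndependent ℝ ![V x₀, W x₀]) {ρ : ℝ} (hρ : 0 < ρ) :
    ∃ r > (0 : ℝ), ∀ x ∈ Metric.closedBall x₀ r, ∀ x' ∈ Metric.closedBall x₀ r,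
      ∃ (τ : ℝ) (γ δ : ℝ → Plane), 0 < τ ∧ γ 0 = x ∧ δ 0 = x' ∧
        (∀ t ∈ Icc (-τ) τ, γ t ∈ Metric.closedBall x₀ ρ ∧
          HasDerivWithinAt γ (V (γ t)) (Icc (-τ) τ) t) ∧
        (∀ t ∈ Icc (-τ) τ, δ t ∈ Metric.closedBall x₀ ρ ∧
          HasDerivWithinAt δ (W (δ t)) (Icc (-τ) τ) t) ∧
        ∃ s ∈ Icc (-τ) τ, ∃ t ∈ Icc (-τ) τ, γ s = δ t := by
  -- the linear approximation
  let L₀ : ℝ × ℝ →ₗ[ℝ] Plane :=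
    (LinearMap.toSpanSingleton ℝ Plane (V x₀)).coprod (LinearMap.toSpanSingleton ℝ Plane (-W x₀))
  have hL₀ : ∀ p, L₀ p = p.1 • V x₀ - p.2 • W x₀ := fun p => by
    simp [L₀, sub_eq_add_neg]
  have hinj : Function.Injective L₀ := by
    rw [← LinearMap.ker_eq_bot, LinearMap.ker_eq_bot']
    rintro ⟨s, t⟩ h
    rw [hL₀] at h
    obtain ⟨h1, h2⟩ := LinearIndependent.pair_iff.1 hli s (-t) (by rw [← h]; module)
    simp only [Prod.mk_eq_zero]
    exact ⟨h1, by linarith⟩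
  let L : (ℝ × ℝ) ≃L[ℝ] Plane :=
    (LinearEquiv.ofInjectiveOfFinrankEq L₀ hinj (by simp)).toContinuousLinearEquiv
  have hL : ∀ p, L p = p.1 • V x₀ - p.2 • W x₀ := hL₀
  set N : ℝ := ‖(L.symm : Plane →L[ℝ] ℝ × ℝ)‖ with hN
  have hNpos : 0 < N := L.norm_symm_pos
  -- Half of the inverse norm of `L⁻¹`: an error of at most `c` leaves the surjectivity constant
  -- `N⁻¹ - c = c`.
  obtain ⟨c, hc0, hcN⟩ : ∃ c : NNReal, 0 < c ∧ (c : ℝ) = N⁻¹ / 2 :=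
    ⟨⟨N⁻¹ / 2, by positivity⟩, show (0 : ℝ) < N⁻¹ / 2 by positivity, rfl⟩
  have hc0' : (0 : ℝ) < c := hc0
  -- a ball where the fields are almost constant
  obtain ⟨ρ₁, hρ₁, hV₁⟩ := Metric.continuousAt_iff.1 hV.continuousAt (c / 2) (by positivity)
  obtain ⟨ρ₂, hρ₂, hW₂⟩ := Metric.continuousAt_iff.1 hW.continuousAt (c / 2) (by positivity)
  set ρ' := min ρ (min (ρ₁ / 2) (ρ₂ / 2)) with hρ'
  have hρ'pos : 0 < ρ' := by positivity
  have hVρ : ∀ y ∈ Metric.closedBall x₀ ρ', ‖V y - V x₀‖ ≤ c / 2 := by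
    intro y hy
    rw [← dist_eq_norm]
    refine (hV₁ (lt_of_le_of_lt (Metric.mem_closedBall.1 hy) ?_)).le
    exact ((min_le_right _ _).trans (min_le_left _ _)).trans_lt (half_lt_self hρ₁)
  have hWρ : ∀ y ∈ Metric.closedBall x₀ ρ', ‖W y - W x₀‖ ≤ c / 2 := by
    intro y hy
    rw [← dist_eq_norm]
    refine (hW₂ (lt_of_le_of_lt (Metric.mem_closedBall.1 hy) ?_)).le
    exact ((min_le_right _ _).trans (min_le_right _ _)).trans_lt (half_lt_self hρ₂)
  obtain ⟨r₁, hr₁, τ₁, hτ₁, hγ⟩ := exists_integralCurve_mem_closedBall hV hρ'pos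
  obtain ⟨r₂, hr₂, τ₂, hτ₂, hδ⟩ := exists_integralCurve_mem_closedBall hW hρ'pos
  set τ := min τ₁ τ₂ with hτ
  have hτpos : 0 < τ := lt_min hτ₁ hτ₂
  have hs₁ : Icc (-τ) τ ⊆ Icc (-τ₁) τ₁ :=
    Icc_subset_Icc (neg_le_neg (min_le_left _ _)) (min_le_left _ _)
  have hs₂ : Icc (-τ) τ ⊆ Icc (-τ₂) τ₂ :=
    Icc_subset_Icc (neg_le_neg (min_le_right _ _)) (min_le_right _ _)
  -- Two starting points are then at most `c τ` apart, the radius of the ball that `γ s - δ t` is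
  -- shown to cover.
  refine ⟨min (min r₁ r₂) (c * τ / 2), by positivity, fun x hx x' hx' => ?_⟩
  obtain ⟨γ, hγ0, hγ⟩ := hγ x (Metric.closedBall_subset_closedBall
    ((min_le_left _ _).trans (min_le_left _ _)) hx)
  obtain ⟨δ, hδ0, hδ⟩ := hδ x' (Metric.closedBall_subset_closedBall
    ((min_le_left _ _).trans (min_le_right _ _)) hx')
  have hsub : Metric.closedBall x₀ ρ' ⊆ Metric.closedBall x₀ ρ :=
    Metric.closedBall_subset_closedBall (min_le_left _ _)
  refine ⟨τ, γ, δ, hτpos, hγ0, hδ0,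
    fun t ht => ⟨hsub (hγ t (hs₁ ht)).1, (hγ t (hs₁ ht)).2.mono hs₁⟩,
    fun t ht => ⟨hsub (hδ t (hs₂ ht)).1, (hδ t (hs₂ ht)).2.mono hs₂⟩, ?_⟩
  have mvt : ∀ (σ : ℝ → Plane) (Z : Plane → Plane),
      (∀ t ∈ Icc (-τ) τ, HasDerivWithinAt σ (Z (σ t)) (Icc (-τ) τ) t ∧ ‖Z (σ t) - Z x₀‖ ≤ c / 2) →
      ∀ s ∈ Icc (-τ) τ, ∀ t ∈ Icc (-τ) τ, ‖σ s - σ t - (s - t) • Z x₀‖ ≤ c / 2 * |s - t| := by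
    intro σ Z hσ s hs t ht
    have h1 := (convex_Icc (-τ) τ).norm_image_sub_le_of_norm_hasDerivWithin_le
      (f := fun t => σ t - t • Z x₀) (f' := fun t => Z (σ t) - (1 : ℝ) • Z x₀) (C := c / 2)
      (fun t ht => (hσ t ht).1.sub ((hasDerivWithinAt_id t _).smul_const (Z x₀)))
      (fun t ht => by simpa using (hσ t ht).2) ht hs
    rw [Real.norm_eq_abs] at h1
    refine le_trans (le_of_eq ?_) h1
    congr 1
    module
  -- A quantitative inverse function argument with bounds uniform in the starting points; no
  -- differentiability of the flow in its initial value is needed.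
  have happ : ApproximatesLinearOn (fun p : ℝ × ℝ => γ p.1 - δ p.2) (L : ℝ × ℝ →L[ℝ] Plane)
      (Metric.closedBall 0 τ) c := by
    have hmem : ∀ p ∈ Metric.closedBall (0 : ℝ × ℝ) τ, p.1 ∈ Icc (-τ) τ ∧ p.2 ∈ Icc (-τ) τ := by
      intro p hp
      rw [mem_closedBall_zero_iff, Prod.norm_def, max_le_iff, Real.norm_eq_abs, Real.norm_eq_abs,
        abs_le, abs_le] at hp
      exact hp
    intro p hp p' hp'
    have h1 := mvt γ V (fun t ht => ⟨(hγ t (hs₁ ht)).2.mono hs₁, hVρ _ (hγ t (hs₁ ht)).1⟩)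
      p.1 (hmem p hp).1 p'.1 (hmem p' hp').1
    have h2 := mvt δ W (fun t ht => ⟨(hδ t (hs₂ ht)).2.mono hs₂, hWρ _ (hδ t (hs₂ ht)).1⟩)
      p.2 (hmem p hp).2 p'.2 (hmem p' hp').2
    have e : γ p.1 - δ p.2 - (γ p'.1 - δ p'.2) - (L : ℝ × ℝ →L[ℝ] Plane) (p - p')
        = (γ p.1 - γ p'.1 - (p.1 - p'.1) • V x₀) - (δ p.2 - δ p'.2 - (p.2 - p'.2) • W x₀) := by
      have : (L : ℝ × ℝ →L[ℝ] Plane) (p - p') = (p.1 - p'.1) • V x₀ - (p.2 - p'.2) • W x₀ := hL _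
      rw [this]
      abel
    have n1 : |p.1 - p'.1| ≤ ‖p - p'‖ := norm_fst_le (p - p')
    have n2 : |p.2 - p'.2| ≤ ‖p - p'‖ := norm_snd_le (p - p')
    rw [e]
    refine (norm_sub_le _ _).trans ?_
    nlinarith
  have hsurj := happ.surjOn_closedBall_of_nonlinearRightInverse L.toNonlinearRightInverse
    hτpos.le subset_rfl
  have hmem : (0 : Plane) ∈ Metric.closedBall ((fun p : ℝ × ℝ => γ p.1 - δ p.2) 0)
      ((((L.toNonlinearRightInverse).nnnorm : ℝ)⁻¹ - c) * τ) := by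
    have e1 : (((L.toNonlinearRightInverse).nnnorm : ℝ)⁻¹ - c) * τ = c * τ := by
      have : ((L.toNonlinearRightInverse).nnnorm : ℝ) = N := rfl
      rw [this, hcN]
      ring
    rw [e1, Metric.mem_closedBall, dist_comm, dist_zero_right]
    simp only [Prod.fst_zero, Prod.snd_zero, hγ0, hδ0]
    rw [← dist_eq_norm]
    have d1 := (Metric.mem_closedBall.1 hx).trans (min_le_right _ _)
    have d2 := (Metric.mem_closedBall.1 hx').trans (min_le_right _ _)
    have := dist_triangle_right x x' x₀
    linarith
  obtain ⟨p, hp, hp0⟩ := hsurj hmem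
  rw [mem_closedBall_zero_iff, Prod.norm_def, max_le_iff, Real.norm_eq_abs, Real.norm_eq_abs,
    abs_le, abs_le] at hp
  exact ⟨p.1, hp.1, p.2, hp.2, sub_eq_zero.1 hp0⟩

/-- Two functions satisfying linear equations along two independent vector fields, and with
vanishing product: one of them vanishes locally. -/
theorem eventually_eq_zero_or_of_mul_eq_zero {U : Set Plane} (hU : IsOpen U) {X Y : Plane → Plane}
    (hX : ContDiffOn ℝ ∞ X U) (hY : ContDiffOn ℝ ∞ Y U) {x₀ : Plane} (hx₀ : x₀ ∈ U)
    (hli : LinearIndependent ℝ ![X x₀, Y x₀]) {b c μ ν : Plane → ℝ}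
    (hb : ∀ q ∈ U, DifferentiableAt ℝ b q) (hc : ∀ q ∈ U, DifferentiableAt ℝ c q)
    (hμ : ContinuousOn μ U) (hν : ContinuousOn ν U) (hYb : ∀ q ∈ U, dirD Y b q = μ q * b q)
    (hXc : ∀ q ∈ U, dirD X c q = ν q * c q) (hbc : ∀ q ∈ U, b q * c q = 0) :
    (∀ᶠ q in 𝓝 x₀, b q = 0) ∨ ∀ᶠ q in 𝓝 x₀, c q = 0 := by
  have hbd : ∀ {f : Plane → ℝ}, ContinuousOn f U → ∀ᶠ q in 𝓝 x₀, |f q| ≤ |f x₀| + 1 := by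
    intro f hf
    have h1 : ContinuousAt (fun q => |f q|) x₀ := (hf.continuousAt (hU.mem_nhds hx₀)).abs
    exact (h1.eventually_lt continuousAt_const (by simp)).mono fun q hq => hq.le
  obtain ⟨ρ, hρ, hball⟩ := Metric.nhds_basis_closedBall.eventually_iff.1
    ((hU.eventually_mem hx₀).and ((hbd hμ).and (hbd hν)))
  have hX1 : ContDiffAt ℝ 1 X x₀ := (hX.contDiffAt (hU.mem_nhds hx₀)).of_le (by simp)
  have hY1 : ContDiffAt ℝ 1 Y x₀ := (hY.contDiffAt (hU.mem_nhds hx₀)).of_le (by simp)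
  obtain ⟨r, hr, hmeet⟩ := exists_integralCurves_meet hX1 hY1 hli hρ
  by_contra! hne
  obtain ⟨hne₁, hne₂⟩ := hne
  rw [Metric.nhds_basis_closedBall.frequently_iff] at hne₁ hne₂
  -- Where the `X`-curve through `x` meets the `Y`-curve through `x'`, either `b` or `c` vanishes;
  -- the linear equation carries this zero back to `b x'` or `c x`, a contradiction.
  obtain ⟨x', hx', hbx'⟩ := hne₁ r hr
  obtain ⟨x, hx, hcx⟩ := hne₂ r hr
  obtain ⟨τ, γ, δ, hτ, hγ0, hδ0, hγ, hδ, s, hs, t, ht, hst⟩ := hmeet x hx x' hx'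
  have h0 : (0 : ℝ) ∈ Icc (-τ) τ := ⟨by linarith, hτ.le⟩
  have hder : ∀ {f m : Plane → ℝ} {Z : Plane → Plane} {σ : ℝ → Plane},
      (∀ q ∈ U, DifferentiableAt ℝ f q) → (∀ q ∈ U, dirD Z f q = m q * f q) →
      (∀ t ∈ Icc (-τ) τ, σ t ∈ Metric.closedBall x₀ ρ ∧
          HasDerivWithinAt σ (Z (σ t)) (Icc (-τ) τ) t) →
      ∀ t ∈ Icc (-τ) τ, HasDerivWithinAt (fun t => f (σ t)) (m (σ t) * f (σ t)) (Icc (-τ) τ) t := by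
    intro f m Z σ hf hZ hσ t ht
    have hσU := (hball (hσ t ht).1).1
    have h1 := (hf _ hσU).hasFDerivAt.comp_hasDerivWithinAt t (hσ t ht).2
    rw [← hZ _ hσU]
    exact h1
  rcases mul_eq_zero.1 (hbc (γ s) (hball (hγ s hs).1).1) with h | h
  · rw [hst] at h
    have := eq_zero_of_linear_ode (y := fun t => b (δ t)) (m := fun t => μ (δ t))
      (hder hb hYb hδ) (fun t ht => (hball (hδ t ht).1).2.1) h0 ht h
    exact hbx' (by simpa [hδ0] using this)
  · have := eq_zero_of_linear_ode (y := fun t => c (γ t)) (m := fun t => ν (γ t))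
      (hder hc hXc hγ) (fun t ht => (hball (hγ t ht).1).2.2) h0 hs h
    exact hcx (by simpa [hγ0] using this)

/-! ### Coordinates adapted to a null field -/

/-- The open rectangle with centre `(s, t)`. -/
def box (s t ε : ℝ) : Set Plane := {q | q 0 ∈ Ioo (s - ε) (s + ε) ∧ q 1 ∈ Ioo (t - ε) (t + ε)}

lemma isOpen_box (s t ε : ℝ) : IsOpen (box s t ε) := by
  have h0 : Continuous (fun q : Plane => q 0) := by fun_prop
  have h1 : Continuous (fun q : Plane => q 1) := by fun_prop
  exact (isOpen_Ioo.preimage h0).inter (isOpen_Ioo.preimage h1)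

lemma exists_box_subset {O : Set Plane} (hO : IsOpen O) {p : Plane} (hp : p ∈ O) :
    ∃ ε > 0, box (p 0) (p 1) ε ⊆ O := by
  obtain ⟨r, hr, hball⟩ := Metric.isOpen_iff.1 hO p hp
  refine ⟨r / 2, half_pos hr, fun q hq => hball ?_⟩
  rw [Metric.mem_ball, dist_eq_norm, eq_sum_basisVec (q - p)]
  have h0 : |q 0 - p 0| < r / 2 := by
    rw [abs_lt]
    constructor <;> linarith [hq.1.1, hq.1.2]
  have h1 : |q 1 - p 1| < r / 2 := by
    rw [abs_lt]
    constructor <;> linarith [hq.2.1, hq.2.2]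
  calc _ ≤ ‖(q - p) 0 • (basisVec 0 : Plane)‖ + ‖(q - p) 1 • (basisVec 1 : Plane)‖ :=
        norm_add_le _ _
    _ = |q 0 - p 0| + |q 1 - p 1| := by simp [norm_smul, basisVec]
    _ < r := by linarith

/-- A map on a rectangle with vanishing first partial derivative depends on the second variable
only. -/
lemma eq_of_pd_zero_eq_zero {W : Type*} [NormedAddCommGroup W] [NormedSpace ℝ W] {s t ε : ℝ}
    (hε : 0 < ε) {f : Plane → W} (hf : ∀ q ∈ box s t ε, DifferentiableAt ℝ f q)
    (hf0 : ∀ q ∈ box s t ε, pd 0 f q = 0) {q : Plane} (hq : q ∈ box s t ε) :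
    f q = f (!₂[s, q 1]) := by
  have hl : ∀ y : ℝ, HasDerivAt (fun y : ℝ => (!₂[y, q 1] : Plane)) (basisVec 0) y := by
    intro y
    have h1 : (fun y : ℝ => (!₂[y, q 1] : Plane))
        = fun y => y • basisVec 0 + q 1 • (basisVec 1 : Plane) := by
      ext y i
      fin_cases i <;> simp [basisVec]
    rw [h1]
    simpa using ((hasDerivAt_id y).smul_const (basisVec 0 : Plane)).add_const
      (q 1 • (basisVec 1 : Plane))
  have hmem : ∀ y ∈ Ioo (s - ε) (s + ε), (!₂[y, q 1] : Plane) ∈ box s t ε := fun y hy =>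
    ⟨by simpa using hy, by simpa using hq.2⟩
  have hd : ∀ y ∈ Ioo (s - ε) (s + ε),
      HasDerivWithinAt (fun y : ℝ => f (!₂[y, q 1])) 0 (Ioo (s - ε) (s + ε)) y := by
    intro y hy
    have h1 := (hf _ (hmem y hy)).hasFDerivAt.comp_hasDerivAt y (hl y)
    have h2 : fderiv ℝ f (!₂[y, q 1]) (basisVec 0) = 0 := hf0 _ (hmem y hy)
    rw [h2] at h1
    exact h1.hasDerivWithinAt
  have h3 := (convex_Ioo (s - ε) (s + ε)).norm_image_sub_le_of_norm_hasDerivWithin_le (C := 0)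
    hd (fun y _ => by simp) (x := s) (y := q 0) ⟨by linarith, by linarith⟩ hq.1
  rw [zero_mul, norm_le_zero_iff, sub_eq_zero] at h3
  have h4 : (!₂[q 0, q 1] : Plane) = q := by
    ext i
    fin_cases i <;> simp
  rw [← h3, h4]

/-- Functions `s, t` with prescribed derivatives along two vector fields are local coordinates. -/
theorem exists_coordinates {V : Set Plane} (hV : IsOpen V) {X Y : Plane → Plane} {s t l : Plane → ℝ}
    (hs : ContDiffOn ℝ ∞ s V) (ht : ContDiffOn ℝ ∞ t V)
    (hspan : ∀ q ∈ V, ∀ v : Plane, ∃ x y : ℝ, v = x • X q + y • Y q)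
    (hl : ∀ q ∈ V, l q ≠ 0) (hXs : ∀ q ∈ V, dirD X s q = (l q)⁻¹)
    (hXt : ∀ q ∈ V, dirD X t q = 0) (hYt : ∀ q ∈ V, dirD Y t q = l q) {q₀ : Plane} (hq₀ : q₀ ∈ V) :
    ∃ (Φ : OpenPartialHomeomorph Plane Plane) (ε : ℝ), 0 < ε ∧ q₀ ∈ Φ.source ∧ Φ.source ⊆ V ∧
      Φ.target = box (s q₀) (t q₀) ε ∧ ContDiffOn ℝ ∞ Φ Φ.source ∧
      ContDiffOn ℝ ∞ Φ.symm Φ.target ∧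
      ∀ q ∈ Φ.target, s (Φ.symm q) = q 0 ∧ t (Φ.symm q) = q 1 ∧
        fderiv ℝ Φ.symm q (basisVec 0) = l (Φ.symm q) • X (Φ.symm q) ∧
        ∃ u : ℝ, fderiv ℝ Φ.symm q (basisVec 1)
          = u • X (Φ.symm q) + (l (Φ.symm q))⁻¹ • Y (Φ.symm q) := by
  set Ψ : Plane → Plane := fun q => s q • basisVec 0 + t q • basisVec 1 with hΨ
  have hΨ0 : ∀ q, Ψ q 0 = s q := fun q => by simp [hΨ, basisVec]
  have hΨ1 : ∀ q, Ψ q 1 = t q := fun q => by simp [hΨ, basisVec]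
  have sΨ : ContDiffOn ℝ ∞ Ψ V :=
    (hs.smul contDiffOn_const).add (ht.smul contDiffOn_const)
  have dΨ : ∀ q ∈ V, ∀ v, fderiv ℝ Ψ q v
      = fderiv ℝ s q v • basisVec 0 + fderiv ℝ t q v • basisVec 1 := by
    intro q hq v
    have h1 := differentiableAt_of_smoothOn hV hs hq
    have h2 := differentiableAt_of_smoothOn hV ht hq
    have := ((h1.hasFDerivAt.smul_const (basisVec 0 : Plane)).add
      (h2.hasFDerivAt.smul_const (basisVec 1 : Plane))).fderiv
    have e : fderiv ℝ Ψ q = _ := this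
    rw [e]
    simp
  have dΨc : ∀ q ∈ V, ∀ x y : ℝ, fderiv ℝ s q (x • X q + y • Y q) = x * (l q)⁻¹ + y * dirD Y s q ∧
      fderiv ℝ t q (x • X q + y • Y q) = y * l q := by
    intro q hq x y
    have e1 : fderiv ℝ s q (X q) = (l q)⁻¹ := hXs q hq
    have e2 : fderiv ℝ t q (X q) = 0 := hXt q hq
    have e3 : fderiv ℝ t q (Y q) = l q := hYt q hq
    simp only [map_add, map_smul, smul_eq_mul, e1, e2, e3, mul_zero, zero_add, dirD, and_self]
  -- With respect to `X, Y` the differential of `Ψ` is triangular with diagonal `l⁻¹, l`.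
  have hinj : ∀ q ∈ V, Function.Injective (fderiv ℝ Ψ q : Plane →ₗ[ℝ] Plane) := by
    intro q hq
    rw [← LinearMap.ker_eq_bot, LinearMap.ker_eq_bot']
    intro v hv
    have hv' : fderiv ℝ Ψ q v = 0 := hv
    obtain ⟨x, y, rfl⟩ := hspan q hq v
    rw [dΨ q hq, (dΨc q hq x y).1, (dΨc q hq x y).2] at hv'
    have z0 := congrArg (fun v : Plane => v 0) hv'
    have z1 := congrArg (fun v : Plane => v 1) hv'
    simp [basisVec, hl q hq] at z0 z1
    rw [z1] at z0 ⊢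
    simp [hl q hq] at z0
    simp [z0]
  have hequiv : ∀ q ∈ V, ∃ L : Plane ≃L[ℝ] Plane, HasFDerivAt Ψ (L : Plane →L[ℝ] Plane) q := by
    intro q hq
    refine ⟨(LinearEquiv.ofInjectiveEndo (fderiv ℝ Ψ q : Plane →ₗ[ℝ] Plane)
      (hinj q hq)).toContinuousLinearEquiv, ?_⟩
    exact (differentiableAt_of_smoothOn hV sΨ hq).hasFDerivAt
  obtain ⟨L, hL⟩ := hequiv q₀ hq₀
  have cΨ : ContDiffAt ℝ ∞ Ψ q₀ := sΨ.contDiffAt (hV.mem_nhds hq₀)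
  set ψ := (cΨ.toOpenPartialHomeomorph Ψ hL (by simp)).restrOpen V hV with hψ
  have hψc : ∀ q, ψ q = Ψ q := fun q => rfl
  have hψs : ψ.source ⊆ V := fun q hq => by
    rw [hψ, OpenPartialHomeomorph.restrOpen_source] at hq
    exact hq.2
  have hq₀ψ : q₀ ∈ ψ.source := by
    rw [hψ, OpenPartialHomeomorph.restrOpen_source]
    exact ⟨cΨ.mem_toOpenPartialHomeomorph_source hL (by simp), hq₀⟩
  -- On a rectangle the level sets of the second coordinate are intervals, so functions constant
  -- along `X` depend on `t` alone.
  obtain ⟨ε, hε, hbox⟩ := exists_box_subset ψ.open_target (ψ.map_source hq₀ψ)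
  rw [hψc, hΨ0, hΨ1] at hbox
  set Φ := (ψ.symm.restrOpen _ (isOpen_box (s q₀) (t q₀) ε)).symm with hΦ
  have hΦt : Φ.target = box (s q₀) (t q₀) ε := by
    have : Φ.target = ψ.target ∩ box (s q₀) (t q₀) ε := by
      rw [hΦ, OpenPartialHomeomorph.symm_target, OpenPartialHomeomorph.restrOpen_source]
      rfl
    rw [this, inter_eq_right]
    exact hbox
  have hΦsymm : ∀ q, Φ.symm q = ψ.symm q := fun q => rfl
  have hΦc : ∀ q, Φ q = Ψ q := fun q => rfl
  have hmemψ : ∀ q ∈ Φ.target, Φ.symm q ∈ ψ.source := fun q hq => by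
    rw [hΦt] at hq
    exact ψ.map_target (hbox hq)
  have hΦs : Φ.source ⊆ V := fun q hq => by
    have h1 := hmemψ _ (Φ.map_source hq)
    rw [Φ.left_inv hq] at h1
    exact hψs h1
  have sΦ : ContDiffOn ℝ ∞ Φ.symm Φ.target := by
    intro q hq
    have h1 := hmemψ q hq
    obtain ⟨L', hL'⟩ := hequiv _ (hψs h1)
    refine ContDiffAt.contDiffWithinAt ?_
    refine Φ.contDiffAt_symm hq (f₀' := L') ?_ ?_
    · exact hL'
    · exact sΨ.contDiffAt (hV.mem_nhds (hψs h1))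
  have hinv : ∀ q ∈ Φ.target, Ψ (Φ.symm q) = q := fun q hq => Φ.right_inv hq
  have hsq : ∀ q ∈ Φ.target, s (Φ.symm q) = q 0 := fun q hq => by rw [← hΨ0, hinv q hq]
  have htq : ∀ q ∈ Φ.target, t (Φ.symm q) = q 1 := fun q hq => by rw [← hΨ1, hinv q hq]
  have hder : ∀ q ∈ Φ.target, ∀ v, fderiv ℝ Ψ (Φ.symm q) (fderiv ℝ Φ.symm q v) = v := by
    intro q hq v
    have h1 := (differentiableAt_of_smoothOn hV sΨ (hψs (hmemψ q hq))).hasFDerivAt.comp q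
      (differentiableAt_of_smoothOn Φ.open_target sΦ hq).hasFDerivAt
    have h2 : (Ψ ∘ Φ.symm) =ᶠ[𝓝 q] id := by
      filter_upwards [Φ.open_target.mem_nhds hq] with r hr
      exact hinv r hr
    have h3 := (h1.congr_of_eventuallyEq h2.symm).unique (hasFDerivAt_id q)
    exact congrArg (fun f : Plane →L[ℝ] Plane => f v) h3
  refine ⟨Φ, ε, hε, ?_, hΦs, hΦt, sΨ.mono hΦs, sΦ, fun q hq => ⟨hsq q hq, htq q hq, ?_, ?_⟩⟩
  · have h1 : Ψ q₀ ∈ Φ.target := by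
      rw [hΦt]
      refine ⟨?_, ?_⟩
      · rw [hΨ0]; constructor <;> linarith
      · rw [hΨ1]; constructor <;> linarith
    have h2 := Φ.map_target h1
    have h3 : Φ.symm (Ψ q₀) = q₀ := ψ.left_inv hq₀ψ
    rwa [h3] at h2
  · have hp := hψs (hmemψ q hq)
    refine hinj _ hp ?_
    change fderiv ℝ Ψ (Φ.symm q) _ = fderiv ℝ Ψ (Φ.symm q) _
    have h1 := dΨc _ hp (l (Φ.symm q)) 0
    rw [zero_smul, add_zero] at h1
    rw [hder q hq, dΨ _ hp, h1.1, h1.2, mul_inv_cancel₀ (hl _ hp)]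
    simp
  · have hp := hψs (hmemψ q hq)
    obtain ⟨x, y, hxy⟩ := hspan _ hp (fderiv ℝ Φ.symm q (basisVec 1))
    refine ⟨x, ?_⟩
    have h1 := hder q hq (basisVec 1)
    rw [hxy, dΨ _ hp, (dΨc _ hp x y).2] at h1
    have z1 := congrArg (fun v : Plane => v 1) h1
    simp [basisVec] at z1
    rw [hxy, eq_inv_of_mul_eq_one_left z1]

/-! ### The quadratic parametrization along the null field. -/

lemma fderiv_comp_apply {W : Type*} [NormedAddCommGroup W] [NormedSpace ℝ W] {f : Plane → W}
    {g : Plane → Plane} {q : Plane} (hf : DifferentiableAt ℝ f (g q))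
    (hg : DifferentiableAt ℝ g q) (v : Plane) :
    fderiv ℝ (f ∘ g) q v = fderiv ℝ f (g q) (fderiv ℝ g q v) := by
  rw [fderiv_comp q hf hg]
  rfl

/-- If `h(X, X)` is a multiple of `ξ`, and this multiple is determined by a non-zero constant
`a d`, the surface is quadratic in suitable null coordinates. -/
theorem AdaptedFrame.exists_quadratic_coordinates {F : Plane → E52} {U : Set Plane}
    {X Y : Plane → Plane} {ξ η : Plane → E52} {ω₁ ω₂ φ₁ φ₂ a b c d : Plane → ℝ}
    (h : AdaptedFrame F U X Y ξ η ω₁ ω₂ φ₁ φ₂ a b c d) (hb : ∀ q ∈ U, b q = 0) {P : ℝ} (hP : P ≠ 0)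
    (had : ∀ q ∈ U, a q * d q = P) {q₀ : Plane} (hq₀ : q₀ ∈ U) :
    ∃ (Φ : OpenPartialHomeomorph Plane Plane) (t₁ t₂ : ℝ) (α β γ : ℝ → E52) (m : Plane → ℝ),
      q₀ ∈ Φ.source ∧ Φ.source ⊆ U ∧ ContDiffOn ℝ ∞ Φ Φ.source ∧
      ContDiffOn ℝ ∞ Φ.symm Φ.target ∧
      ContDiffOn ℝ ∞ α (Ioo t₁ t₂) ∧ ContDiffOn ℝ ∞ β (Ioo t₁ t₂) ∧
      ContDiffOn ℝ ∞ γ (Ioo t₁ t₂) ∧ ContDiffOn ℝ ∞ m Φ.target ∧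
      ∀ q ∈ Φ.target, q 1 ∈ Ioo t₁ t₂ ∧
        F (Φ.symm q) = (q 0 ^ 2 / 2) • α (q 1) + q 0 • β (q 1) + γ (q 1) ∧
        ∀ y z : Plane, inducedMetric (F ∘ Φ.symm) q y z =
          -(y 0 * z 1 + y 1 * z 0) + 2 * m q * (y 1 * z 1) := by
  have hU := h.isOpen
  have ha0 : ∀ q ∈ U, a q ≠ 0 := fun q hq h0 => hP (by rw [← had q hq, h0, zero_mul])
  have hd0 : ∀ q ∈ U, d q ≠ 0 := fun q hq h0 => hP (by rw [← had q hq, h0, mul_zero])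
  have sE := smoothOn_dirD hU h.smooth_X h.smooth_F
  have comp : ∀ {f : Plane → E52}, ContDiffOn ℝ ∞ f U → ∀ i, ContDiffOn ℝ ∞ (fun q => f q i) U :=
    fun hf i => contDiffOn_pi.1 hf i
  -- a chart of the projective space around the direction of `ξ`
  obtain ⟨j, hj⟩ : ∃ j, ξ q₀ j ≠ 0 := by
    by_contra! hne
    have := (h.basis q₀ hq₀).n₁₂
    rw [show ξ q₀ = 0 from funext hne, ip_zero_left] at this
    linarith
  -- `dF(X)` and `ξ` are independent, so some minor containing row `j` is non-zero. Up to the factor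
  -- `d`, this minor governs `Y t`.
  obtain ⟨i, hi⟩ : ∃ i, dirD X F q₀ i * ξ q₀ j - ξ q₀ i * dirD X F q₀ j ≠ 0 := by
    by_contra! hne
    have B := h.basis q₀ hq₀
    have e : dirD X F q₀ = (dirD X F q₀ j / ξ q₀ j) • ξ q₀ := by
      ext i
      have := hne i
      simp only [Pi.smul_apply, smul_eq_mul]
      field_simp
      linarith
    have h1 := B.e₁₂
    rw [e, ip_smul_left, B.ne₁₂] at h1
    linarith
  have hw : ContinuousOn (fun q => dirD X F q i * ξ q j - ξ q i * dirD X F q j) U :=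
    (((comp sE i).mul (comp h.smooth_ξ j)).sub ((comp h.smooth_ξ i).mul (comp sE j))).continuousOn
  set V := (U ∩ (fun q => ξ q j) ⁻¹' {0}ᶜ) ∩
    (U ∩ (fun q => dirD X F q i * ξ q j - ξ q i * dirD X F q j) ⁻¹' {0}ᶜ) with hVdef
  have hV : IsOpen V :=
    ((comp h.smooth_ξ j).continuousOn.isOpen_inter_preimage hU isOpen_compl_singleton).inter
      (hw.isOpen_inter_preimage hU isOpen_compl_singleton)
  have hVU : V ⊆ U := fun q hq => hq.1.1
  have hq₀V : q₀ ∈ V := ⟨⟨hq₀, hj⟩, hq₀, hi⟩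
  have hξj : ∀ q ∈ V, ξ q j ≠ 0 := fun q hq => hq.1.2
  have hwq : ∀ q ∈ V, dirD X F q i * ξ q j - ξ q i * dirD X F q j ≠ 0 := fun q hq => hq.2.2
  replace h := h.mono hV hVU
  replace sE := sE.mono hVU
  replace ha0 : ∀ q ∈ V, a q ≠ 0 := fun q hq => ha0 q (hVU hq)
  replace hd0 : ∀ q ∈ V, d q ≠ 0 := fun q hq => hd0 q (hVU hq)
  replace hb : ∀ q ∈ V, b q = 0 := fun q hq => hb q (hVU hq)
  replace had : ∀ q ∈ V, a q * d q = P := fun q hq => had q (hVU hq)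
  have comp : ∀ {f : Plane → E52}, ContDiffOn ℝ ∞ f V → ∀ i, ContDiffOn ℝ ∞ (fun q => f q i) V :=
    fun hf i => contDiffOn_pi.1 hf i
  have D {W : Type} [NormedAddCommGroup W] [NormedSpace ℝ W] {f : Plane → W} {q : Plane}
    (hf : ContDiffOn ℝ ∞ f V) (hq : q ∈ V) := differentiableAt_of_smoothOn hV hf hq
  have hXξ : ∀ q ∈ V, dirD X ξ q = φ₁ q • ξ q := fun q hq => by
    rw [h.dXξ q hq, hb q hq, zero_smul, sub_zero]
  have hXX : ∀ q ∈ V, dirD X (dirD X F) q = ω₁ q • dirD X F q + a q • ξ q := fun q hq => by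
    rw [h.dXX q hq, hb q hq, zero_smul, add_zero]
  -- the second coordinate
  set t : Plane → ℝ := fun q => ξ q i / ξ q j with ht
  have st : ContDiffOn ℝ ∞ t V := (comp h.smooth_ξ i).div (comp h.smooth_ξ j) hξj
  have htm : EqOn (fun q => t q * ξ q j) (fun q => ξ q i) V := fun q hq =>
    div_mul_cancel₀ _ (hξj q hq)
  have dt : ∀ q ∈ V, ∀ Z, dirD Z t q * ξ q j + t q * dirD Z ξ q j = dirD Z ξ q i := by
    intro q hq Z
    have := dirD_congr (X := Z) hV htm hq
    rwa [dirD_mul (D st hq) (D (comp h.smooth_ξ j) hq), dirD_apply (D h.smooth_ξ hq),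
      dirD_apply (D h.smooth_ξ hq)] at this
  have hXt : ∀ q ∈ V, dirD X t q = 0 := by
    intro q hq
    have h1 := dt q hq X
    have e : t q * ξ q j = ξ q i := htm hq
    rw [hXξ q hq, Pi.smul_apply, Pi.smul_apply, smul_eq_mul, smul_eq_mul, ← e] at h1
    have h2 : dirD X t q * ξ q j = 0 := by linarith
    exact (mul_eq_zero.1 h2).resolve_right (hξj q hq)
  set l : Plane → ℝ := dirD Y t with hl
  have sl : ContDiffOn ℝ ∞ l V := smoothOn_dirD hV h.smooth_Y st
  have hl0 : ∀ q ∈ V, l q ≠ 0 := by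
    intro q hq h0
    have h1 := dt q hq Y
    have h0' : dirD Y t q = 0 := h0
    have e : t q * ξ q j = ξ q i := htm hq
    rw [h0', h.dYξ q hq] at h1
    simp only [Pi.sub_apply, Pi.smul_apply, smul_eq_mul, ← e] at h1
    have h2 : d q * (dirD X F q i * ξ q j - ξ q i * dirD X F q j) = 0 := by
      rw [← e]
      linear_combination ξ q j * h1
    exact (mul_ne_zero (hd0 q hq) (hwq q hq)) h2
  have hXl : ∀ q ∈ V, dirD X l q = -ω₁ q * l q := by
    intro q hq
    have h1 := h.dirD_comm hq st
    have h2 : dirD Y (dirD X t) q = 0 := by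
      rw [dirD_congr hV (f := dirD X t) (g := fun _ => (0 : ℝ)) hXt hq, dirD_const]
    rw [h2, hXt q hq, smul_zero, sub_zero, zero_add] at h1
    exact h1
  -- the derivative of the null field with respect to the coordinates
  set A : Plane → E52 := fun q => (l q ^ 2 * a q) • ξ q with hA
  have sA : ContDiffOn ℝ ∞ A V := ((sl.pow 2).mul h.smooth_a).smul h.smooth_ξ
  -- The rates of `l²`, `a` and `ξ` along `X` are `-2 ω₁`, `2 ω₁ - φ₁` and `φ₁`, with sum zero.
  have hXA : ∀ q ∈ V, dirD X A q = 0 := by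
    intro q hq
    have e : A = fun q => (l q * l q * a q) • ξ q := by
      ext1 q
      simp only [hA, sq]
    have := D sl hq
    have := D h.smooth_a hq
    have := D h.smooth_ξ hq
    rw [e]
    simp (disch := fun_prop) only [dirD_smul, dirD_mul, hXl q hq, h.dirD_X_a hP had hq, hXξ q hq]
    module
  set H : Plane → E52 := fun q => l q • dirD X F q with hH
  have sH : ContDiffOn ℝ ∞ H V := sl.smul sE
  -- Thus `A` is the second derivative of `F` along `l X`: the factor `l` removes the tangential
  -- term `ω₁ dF(X)`.
  have hXH : ∀ q ∈ V, dirD X H q = (l q)⁻¹ • A q := by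
    intro q hq
    rw [hH, dirD_smul (D sl hq) (D sE hq), hXl q hq, hXX q hq, hA]
    have := hl0 q hq
    match_scalars
    · ring
    · field_simp
  -- the first coordinate
  set s : Plane → ℝ := fun q => H q j / A q j with hs
  have hAj : ∀ q ∈ V, A q j ≠ 0 := fun q hq =>
    mul_ne_zero (mul_ne_zero (pow_ne_zero 2 (hl0 q hq)) (ha0 q hq)) (hξj q hq)
  have ss : ContDiffOn ℝ ∞ s V := (comp sH j).div (comp sA j) hAj
  have hXs : ∀ q ∈ V, dirD X s q = (l q)⁻¹ := by
    intro q hq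
    have e : EqOn (fun q => s q * A q j) (fun q => H q j) V := fun q hq =>
      div_mul_cancel₀ _ (hAj q hq)
    have h1 := dirD_congr (X := X) hV e hq
    rw [dirD_mul (D ss hq) (D (comp sA j) hq), dirD_apply (D sA hq), dirD_apply (D sH hq),
      hXA q hq, hXH q hq, Pi.zero_apply, mul_zero, add_zero, Pi.smul_apply, smul_eq_mul] at h1
    exact mul_right_cancel₀ (hAj q hq) h1
  obtain ⟨Φ, ε, hε, hΦ₀, hΦs, hΦt, sΦ, sΦ', hΦ⟩ := exists_coordinates hV ss st
    (fun q hq v => ⟨_, _, h.field_expand hq v⟩) hl0 hXs hXt (fun q _ => rfl) hq₀V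
  have hmem : ∀ q ∈ Φ.target, Φ.symm q ∈ V := fun q hq => hΦs (Φ.map_target hq)
  have DΦ : ∀ q ∈ Φ.target, DifferentiableAt ℝ Φ.symm q := fun q hq =>
    differentiableAt_of_smoothOn Φ.open_target sΦ' hq
  have pd0 : ∀ {f : Plane → E52}, ContDiffOn ℝ ∞ f V → ∀ q ∈ Φ.target,
      pd 0 (f ∘ Φ.symm) q = l (Φ.symm q) • dirD X f (Φ.symm q) := by
    intro f hf q hq
    unfold pd
    rw [fderiv_comp_apply (D hf (hmem q hq)) (DΦ q hq), (hΦ q hq).2.2.1, map_smul]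
    rfl
  -- functions which are constant along the null field
  have along : ∀ {f : Plane → E52}, ContDiffOn ℝ ∞ f V → (∀ q ∈ V, dirD X f q = 0) →
      ∀ q ∈ Φ.target, f (Φ.symm q) = f (Φ.symm (!₂[s q₀, q 1])) := by
    intro f hf hXf q hq
    refine eq_of_pd_zero_eq_zero (f := f ∘ Φ.symm) (s := s q₀) (t := t q₀) hε ?_ ?_ (hΦt ▸ hq)
    · intro r hr
      rw [← hΦt] at hr
      exact (D hf (hmem r hr)).comp r (DΦ r hr)
    · intro r hr
      rw [← hΦt] at hr
      rw [pd0 hf r hr, hXf _ (hmem r hr), smul_zero]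
  have smooth_slice : ∀ {f : Plane → E52}, ContDiffOn ℝ ∞ f V →
      ContDiffOn ℝ ∞ (fun y : ℝ => f (Φ.symm (!₂[s q₀, y]))) (Ioo (t q₀ - ε) (t q₀ + ε)) := by
    intro f hf
    have hline : ContDiff ℝ ∞ (fun y : ℝ => (!₂[s q₀, y] : Plane)) := by
      rw [contDiff_euclidean]
      intro k
      fin_cases k
      · simpa using contDiff_const
      · change ContDiff ℝ ∞ fun y : ℝ => y
        exact contDiff_id
    refine (hf.comp sΦ' hmem).comp hline.contDiffOn (fun y hy => ?_)
    rw [hΦt]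
    exact ⟨by simpa using hε, by simpa using hy⟩
  -- `B` and the map `C` below are the Taylor coefficients of `F` of order one and zero at `s = 0`,
  -- continued as constants along `X`.
  set B : Plane → E52 := fun q => H q - s q • A q with hB
  have sB : ContDiffOn ℝ ∞ B V := sH.sub (ss.smul sA)
  have hXB : ∀ q ∈ V, dirD X B q = 0 := by
    intro q hq
    have := D ss hq
    have := D sA hq
    have := D sH hq
    rw [hB]
    simp (disch := fun_prop) only [dirD_sub, dirD_smul, hXs q hq, hXA q hq, hXH q hq]
    module
  set C : Plane → E52 := fun q => F q - s q • B q - (s q * s q * (1 / 2)) • A q with hC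
  have sC : ContDiffOn ℝ ∞ C V :=
    (h.smooth_F.sub (ss.smul sB)).sub (((ss.mul ss).mul contDiffOn_const).smul sA)
  have hXC : ∀ q ∈ V, dirD X C q = 0 := by
    intro q hq
    have := D ss hq
    have := D sA hq
    have := D sB hq
    have := D h.smooth_F hq
    rw [hC]
    simp (disch := fun_prop) only [dirD_sub, dirD_smul, dirD_mul, dirD_const, hXs q hq, hXA q hq,
      hXB q hq]
    have hF : dirD X F q = (l q)⁻¹ • (B q + s q • A q) := by
      simp only [hB, hH, sub_add_cancel]
      rw [smul_smul, inv_mul_cancel₀ (hl0 q hq), one_smul]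
    rw [hF]
    module
  have sG : ContDiffOn ℝ ∞ (F ∘ Φ.symm) Φ.target := h.smooth_F.comp sΦ' hmem
  have sG1 : ContDiffOn ℝ ∞ (pd 1 (F ∘ Φ.symm)) Φ.target :=
    smoothOn_dirD (X := fun _ => basisVec 1) Φ.open_target contDiffOn_const sG
  -- The coefficients are read off on the slice `s = s q₀` through the centre of the rectangle, as
  -- `s = 0` may lie outside it.
  refine ⟨Φ, t q₀ - ε, t q₀ + ε, fun y => A (Φ.symm (!₂[s q₀, y])),
    fun y => B (Φ.symm (!₂[s q₀, y])), fun y => C (Φ.symm (!₂[s q₀, y])),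
    fun q => 1 / 2 * ip (pd 1 (F ∘ Φ.symm) q) (pd 1 (F ∘ Φ.symm) q), hΦ₀, hΦs.trans hVU, sΦ, sΦ',
    smooth_slice sA, smooth_slice sB, smooth_slice sC,
    contDiffOn_const.mul (smoothOn_ip sG1 sG1), fun q hq => ⟨?_, ?_, fun y z => ?_⟩⟩
  · rw [hΦt] at hq
    exact hq.2
  · simp only
    rw [← along sA hXA q hq, ← along sB hXB q hq, ← along sC hXC q hq, ← (hΦ q hq).1]
    simp only [hC]
    module
  · have bs := h.basis _ (hmem q hq)
    have g0 : pd 0 (F ∘ Φ.symm) q = l (Φ.symm q) • dirD X F (Φ.symm q) := pd0 h.smooth_F q hq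
    obtain ⟨u, hu⟩ := (hΦ q hq).2.2.2
    have g1 : pd 1 (F ∘ Φ.symm) q
        = u • dirD X F (Φ.symm q) + (l (Φ.symm q))⁻¹ • dirD Y F (Φ.symm q) := by
      unfold pd
      rw [fderiv_comp_apply (D h.smooth_F (hmem q hq)) (DΦ q hq), hu, map_add, map_smul, map_smul]
      rfl
    have g00 : ip (pd 0 (F ∘ Φ.symm) q) (pd 0 (F ∘ Φ.symm) q) = 0 := by
      rw [g0, ip_smul_left, ip_smul_right, bs.e₁₁, mul_zero, mul_zero]
    have g01 : ip (pd 0 (F ∘ Φ.symm) q) (pd 1 (F ∘ Φ.symm) q) = -1 := by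
      have := hl0 _ (hmem q hq)
      rw [g0, g1, ip_smul_left, ip_add_right, ip_smul_right, ip_smul_right, bs.e₁₁, bs.e₁₂]
      field_simp
      ring
    unfold inducedMetric
    rw [fderiv_eq_sum_pd _ q y, fderiv_eq_sum_pd _ q z]
    simp only [ip_add_left, ip_add_right, ip_smul_left, ip_smul_right, g00, g01,
      ip_comm (pd 1 (F ∘ Φ.symm) q) (pd 0 (F ∘ Φ.symm) q)]
    ring

/-! ### Reduction to `b = 0`, and the conclusion. -/

lemma isPseudoOrthonormalFrame_mono {F : Plane → E52} {U V : Set Plane} {X Y : Plane → Plane}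
    {ξ η : Plane → E52} (h : IsPseudoOrthonormalFrame F U X Y ξ η) (hVU : V ⊆ U) :
    IsPseudoOrthonormalFrame F V X Y ξ η :=
  ⟨h.smooth₁.mono hVU, h.smooth₂.mono hVU, h.smooth₃.mono hVU, h.smooth₄.mono hVU,
    fun q hq => h.tangent₁₁ q (hVU hq), fun q hq => h.tangent₁₂ q (hVU hq),
    fun q hq => h.tangent₂₂ q (hVU hq), fun q hq => h.normal₃ q (hVU hq),
    fun q hq => h.normal₄ q (hVU hq), fun q hq => h.normal₃₃ q (hVU hq),
    fun q hq => h.normal₃₄ q (hVU hq), fun q hq => h.normal₄₄ q (hVU hq)⟩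

/-- If `a d` is a non-zero constant and `b c` vanishes, then, possibly after an exchange of the
tangent fields, `h(X, X)` is locally a multiple of `ξ`. -/
lemma AdaptedFrame.exists_frame_eq_zero {F : Plane → E52} {U : Set Plane}
    {X Y : Plane → Plane} {ξ η : Plane → E52} {ω₁ ω₂ φ₁ φ₂ a b c d : Plane → ℝ}
    (h : AdaptedFrame F U X Y ξ η ω₁ ω₂ φ₁ φ₂ a b c d) {P : ℝ}
    (had : ∀ q ∈ U, a q * d q = P) (hbc : ∀ q ∈ U, b q * c q = 0) {q₀ : Plane} (hq₀ : q₀ ∈ U) :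
    ∃ (V : Set Plane) (X Y : Plane → Plane) (ξ η : Plane → E52)
      (ω₁ ω₂ φ₁ φ₂ a b c d : Plane → ℝ), V ⊆ U ∧ q₀ ∈ V ∧
      AdaptedFrame F V X Y ξ η ω₁ ω₂ φ₁ φ₂ a b c d ∧ (∀ q ∈ V, b q = 0) ∧
      ∀ q ∈ V, a q * d q = P := by
  have hU := h.isOpen
  have hli : LinearIndependent ℝ ![X q₀, Y q₀] := by
    rw [LinearIndependent.pair_iff]
    intro x y hxy
    have h1 := congrArg (fderiv ℝ F q₀) hxy
    rw [map_add, map_smul, map_smul, map_zero] at h1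
    have := (h.basis q₀ hq₀).coeff_eq_zero (x := x) (y := y) (z := 0) (w := 0) (u := 0)
      (by simpa [dirD] using h1)
    exact ⟨this.1, this.2.1⟩
  have D {f : Plane → ℝ} (hf : ContDiffOn ℝ ∞ f U) := fun q (hq : q ∈ U) =>
    differentiableAt_of_smoothOn hU hf hq
  have cμ : ContinuousOn (fun q => 2 * ω₂ q + φ₂ q) U :=
    (continuousOn_const.mul h.smooth_ω₂.continuousOn).add h.smooth_φ₂.continuousOn
  have cν : ContinuousOn (fun q => -(2 * ω₁ q + φ₁ q)) U :=
    ((continuousOn_const.mul h.smooth_ω₁.continuousOn).add h.smooth_φ₁.continuousOn).neg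
  rcases eventually_eq_zero_or_of_mul_eq_zero hU h.smooth_X h.smooth_Y hq₀ hli (D h.smooth_b)
    (D h.smooth_c) cμ cν (fun q hq => (h.codazzi_gauss hq).2.1) (fun q hq => h.codazzi_c hq) hbc
    with hz | hz
  · obtain ⟨V, hV, hVo, hqV⟩ := eventually_nhds_iff.1 (hz.and (hU.eventually_mem hq₀))
    have hVU : V ⊆ U := fun q hq => (hV q hq).2
    exact ⟨V, X, Y, ξ, η, _, _, _, _, a, b, c, d, hVU, hqV, h.mono hVo hVU,
      fun q hq => (hV q hq).1, fun q hq => had q (hVU hq)⟩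
  · obtain ⟨V, hV, hVo, hqV⟩ := eventually_nhds_iff.1 (hz.and (hU.eventually_mem hq₀))
    have hVU : V ⊆ U := fun q hq => (hV q hq).2
    exact ⟨V, Y, X, η, ξ, _, _, _, _, d, c, b, a, hVU, hqV, h.swap_tangent.mono hVo hVU,
      fun q hq => (hV q hq).1, fun q hq => by rw [mul_comm]; exact had q (hVU hq)⟩

/-- A minimal surface with constant Gaussian curvature and non-zero constant normal curvature has
local adapted frames for which `h(X, X)` is a null vector and `a d` is a non-zero constant. -/
theorem exists_adaptedFrame_of_const_curvature {F : Plane → E52} {Ω : Set Plane} (hΩ : IsOpen Ω)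
    (hF : ContDiffOn ℝ ∞ F Ω) (hS : ∀ q ∈ Ω, ip (F q) (F q) = 1)
    (hmin : ∀ q ∈ Ω, meanCurvature F q = 0) {K κ : ℝ} (hK : ∀ q ∈ Ω, gaussK F q = K)
    (hκ : ∀ q ∈ Ω, IsNormalCurvatureAt F q κ) (hκ0 : κ ≠ 0) {q₀ : Plane} (hq₀ : q₀ ∈ Ω) :
    ∃ (P : ℝ) (V : Set Plane) (X Y : Plane → Plane) (ξ η : Plane → E52)
      (ω₁ ω₂ φ₁ φ₂ a b c d : Plane → ℝ), P ≠ 0 ∧ V ⊆ Ω ∧ q₀ ∈ V ∧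
      AdaptedFrame F V X Y ξ η ω₁ ω₂ φ₁ φ₂ a b c d ∧ (∀ q ∈ V, b q = 0) ∧
      ∀ q ∈ V, a q * d q = P := by
  obtain ⟨U₀, X, Y, ξ, η, hU₀, hq₀U, hfr, -⟩ := hκ q₀ hq₀
  obtain ⟨r, hr, hball⟩ := Metric.isOpen_iff.1 (hU₀.inter hΩ) q₀ ⟨hq₀U, hq₀⟩
  set U := Metric.ball q₀ r with hUdef
  have hU : IsOpen U := Metric.isOpen_ball
  have hq₀' : q₀ ∈ U := Metric.mem_ball_self hr
  have hUΩ : U ⊆ Ω := fun q hq => (hball hq).2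
  obtain ⟨ω₁, ω₂, φ₁, φ₂, a, b, c, d, h⟩ := exists_adaptedFrame hU (hF.mono hUΩ)
    (fun q hq => hS q (hUΩ hq)) (fun q hq => hmin q (hUΩ hq))
    (isPseudoOrthonormalFrame_mono hfr fun q hq => (hball hq).1)
  have hsum : ∀ q ∈ U, a q * d q + b q * c q = K - 1 := fun q hq => by
    linarith [h.gaussK_eq hq, hK q (hUΩ hq)]
  -- The frame realizing `κ` varies with the point, so only squares can be compared with the fixed
  -- frame; connectedness of the ball then fixes the sign.
  have hsq : ∀ q ∈ U, (a q * d q - b q * c q) ^ 2 = κ ^ 2 := by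
    intro q hq
    obtain ⟨U', X', Y', ξ', η', hU', hqU', hfr', hκ'⟩ := hκ q (hUΩ hq)
    have hsub : U' ∩ Ω ⊆ Ω := inter_subset_right
    obtain ⟨ω₁', ω₂', φ₁', φ₂', a', b', c', d', h'⟩ := exists_adaptedFrame (hU'.inter hΩ)
      (hF.mono hsub) (fun q hq => hS q (hsub hq)) (fun q hq => hmin q (hsub hq))
      (isPseudoOrthonormalFrame_mono hfr' inter_subset_left)
    have hqU'' : q ∈ U' ∩ Ω := ⟨hqU', hUΩ hq⟩
    rw [hκ', h'.normalCurv_eq hqU'', h.normalCurv_sq_eq hq h' hqU'']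
  have hconst : ∃ k : ℝ, k ≠ 0 ∧ ∀ q ∈ U, a q * d q - b q * c q = k := by
    have hcont : ContinuousOn (fun q => a q * d q - b q * c q) U :=
      ((h.smooth_a.mul h.smooth_d).sub (h.smooth_b.mul h.smooth_c)).continuousOn
    rcases (convex_ball q₀ r).isPreconnected.eq_or_eq_neg_of_sq_eq hcont
      (continuousOn_const (c := κ)) (fun q hq => hsq q hq) (fun _ => hκ0) with hk | hk
    · exact ⟨κ, hκ0, fun q hq => hk hq⟩
    · exact ⟨-κ, neg_ne_zero.2 hκ0, fun q hq => hk hq⟩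
  obtain ⟨k, hk0, hk⟩ := hconst
  have had : ∀ q ∈ U, a q * d q = (K - 1 + k) / 2 := fun q hq => by
    linarith [hsum q hq, hk q hq]
  have hbc : ∀ q ∈ U, b q * c q = (K - 1 - k) / 2 := fun q hq => by
    linarith [hsum q hq, hk q hq]
  have hne : (K - 1 + k) / 2 ≠ (K - 1 - k) / 2 := fun e => hk0 (by linarith)
  -- The two constants differ by `k ≠ 0`, so the one that is not shown to vanish is non-zero. If `a
  -- d = 0`, exchange `ξ` and `η`.
  rcases h.mul_eq_zero_of_const had hbc hne hq₀' with h0 | h0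
  · rw [h0] at had hne
    obtain ⟨V, X, Y, ξ, η, ω₁, ω₂, φ₁, φ₂, a, b, c, d, hVU, hV⟩ :=
      h.swap_normal.exists_frame_eq_zero hbc had hq₀'
    exact ⟨_, V, X, Y, ξ, η, ω₁, ω₂, φ₁, φ₂, a, b, c, d, hne.symm, hVU.trans hUΩ, hV⟩
  · rw [h0] at hbc hne
    obtain ⟨V, X, Y, ξ, η, ω₁, ω₂, φ₁, φ₂, a, b, c, d, hVU, hV⟩ :=
      h.exists_frame_eq_zero had hbc hq₀'
    exact ⟨_, V, X, Y, ξ, η, ω₁, ω₂, φ₁, φ₂, a, b, c, d, hne, hVU.trans hUΩ, hV⟩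

end

theorem proposition3p4 {M : Type*} [TopologicalSpace M] [ChartedSpace Plane M]
    [IsManifold (𝓡 2) ∞ M] (x : M → E52) (hx : IsLorentzianSurface x) (hmin : IsMinimal x)
    (K κ : ℝ) (hK : HasGaussianCurvature x K) (hκ : HasNormalCurvature x κ) (hκ0 : κ ≠ 0) :
    ∀ p : M, ∃ (e : OpenPartialHomeomorph M Plane) (A : E52 ≃ₗ[ℝ] E52) (a b : ℝ)
      (α β γ : ℝ → E52) (m : Plane → ℝ),
      e ∈ IsManifold.maximalAtlas (𝓡 2) ∞ M ∧ p ∈ e.source ∧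
      (∀ v w, ip (A v) (A w) = ip v w) ∧
      ContDiffOn ℝ ∞ α (Set.Ioo a b) ∧ ContDiffOn ℝ ∞ β (Set.Ioo a b) ∧
      ContDiffOn ℝ ∞ γ (Set.Ioo a b) ∧ ContDiffOn ℝ ∞ m e.target ∧
      ∀ q ∈ e.target,
        q 1 ∈ Set.Ioo a b ∧
        A (x (e.symm q)) = (q 0 ^ 2 / 2) • α (q 1) + q 0 • β (q 1) + γ (q 1) ∧
        ∀ y z : Plane, inducedMetric (x ∘ e.symm) q y z =
          -(y 0 * z 1 + y 1 * z 0) + 2 * m q * (y 1 * z 1) := by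
  intro p
  have he := IsManifold.chart_mem_maximalAtlas (I := 𝓡 2) (n := ∞) p
  set e := chartAt Plane p
  have hsymm := contMDiffOn_symm_of_mem_maximalAtlas he
  have hF : ContDiffOn ℝ ∞ (x ∘ e.symm) e.target :=
    contMDiffOn_iff_contDiffOn.1 (hx.smooth.comp_contMDiffOn hsymm)
  have hp : p ∈ e.source := mem_chart_source Plane p
  obtain ⟨P, V, X, Y, ξ, η, ω₁, ω₂, φ₁, φ₂, a, b, c, d, hP, hV, hpV, h, hb, had⟩ :=
    exists_adaptedFrame_of_const_curvature e.open_target hF (fun q _ => hx.mem_sphere _)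
      (hmin e he) (hK e he) (hκ e he) hκ0 (e.map_source hp)
  obtain ⟨Φ, t₁, t₂, α, β, γ, m, hpΦ, hΦV, sΦ, sΦ', sα, sβ, sγ, sm, hΦ⟩ :=
    h.exists_quadratic_coordinates hb hP had hpV
  have htarget : (e.trans Φ).target = Φ.target := by
    rw [OpenPartialHomeomorph.trans_target, Set.inter_eq_left]
    exact fun q hq => hV (hΦV (Φ.map_target hq))
  have hsource : (e.trans Φ).source ⊆ e.source := by
    rw [OpenPartialHomeomorph.trans_source]
    exact Set.inter_subset_left
  -- The position vector itself is quadratic, so the identity serves as the isometry.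
  refine ⟨e.trans Φ, LinearEquiv.refl ℝ E52, t₁, t₂, α, β, γ, m, ?_, ?_, fun v w => rfl, sα, sβ, sγ,
    htarget ▸ sm, fun q hq => hΦ q (htarget ▸ hq)⟩
  · refine OpenPartialHomeomorph.mem_maximalAtlas_of_contMDiffOn _ ?_ ?_
    · refine (contMDiffOn_iff_contDiffOn.2 sΦ).comp
        ((contMDiffOn_of_mem_maximalAtlas he).mono hsource) fun q hq => ?_
      rw [OpenPartialHomeomorph.trans_source] at hq
      exact hq.2
    · rw [htarget]
      exact hsymm.comp (contMDiffOn_iff_contDiffOn.2 sΦ')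
        fun q hq => hV (hΦV (Φ.map_target hq))
  · rw [OpenPartialHomeomorph.trans_source]
    exact ⟨hp, hpΦ⟩
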